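/- Let $f,g\in\mathbb{C}\{x,y\}$ be nonzero germs of holomorphic functions at the origin of $\mathbb{C}^2$ with $f(0,0)=g(0,0)=0$. Write $f=u\,y^{E_1}\prod_{i=1}^p(x-\alpha_i(y))$ and $g=u'\,y^{E_2}\prod_{j=1}^q(x-\beta_j(y))$ with $u,u'$ units and $\alpha_i,\beta_j$ fractional power series (arcs) of positive order in $y$. Assume that the $N=p+q$ roots $\alpha_1,\dots,\alpha_p,\beta_1,\dots,\beta_q$, also written $\lambda_1,\dots,\lambda_N$, are pairwise distinct. A *polar root* is an arc $x=\gamma(y)$ with $O_y(\gamma)>0$, $J(\gamma(y),y)=0$ and $f(\gamma(y),y)\,g(\gamma(y),y)\neq 0$, where $J=f_yg_x-f_xg_y$; polar roots are counted with their multiplicities as roots of $J$. *The tree model.* The ground bar $B_*$ has height $h(B_*)=0$ and $\lambda_{B_*}=0$; on it grows the main trunk, the set of all roots $\lambda_k$. On top of each trunk $T$ (a set of roots) with at least two elements there is a bar $B$ of finite height $h(B)=\min\{O_y(\lambda-\mu):\lambda,\mu\in T\}$; the trunks growing on $B$ are the classes of $T$ under the relation $O_y(\lambda-\mu)>h(B)$,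 and $\lambda_B$ is any $\lambda\in T$ with all terms $y^e$, $e\ge h(B)$, omitted. Repeating this gives all bars of finite height. An arc $\xi$ *climbs over $B$ at* $a\in\mathbb{C}$ if $\xi=\lambda_B+a\,y^{h(B)}+(\text{higher order terms})$. Let $B$ be a bar of finite height, let $z_1,\dots,z_l$ be the distinct points at which roots $\lambda_k$ climb over $B$, and let $p_k$ (resp. $q_k$) be the number of $\alpha_i$ (resp. $\beta_j$) climbing over $B$ at $z_k$. For $F=f,g$ let $\nu_F(B)$ be the order in $y$ of $F(\lambda_B(y)+z\,y^{h(B)},y)$ for generic $z$ (so $\nu_f(B_*)=E_1$, $\nu_g(B_*)=E_2$), and put $$\Delta_B(z_k)=\nu_f(B)\,q_k-\nu_g(B)\,p_k,\qquad \mathscr M_B(z)=\sum_{k=1}^l\frac{\Delta_B(z_k)}{z-z_k}.$$ The point $z_k$ is *non-collinear* if $\Delta_B(z_k)\ne0$. Let $N(B)$ be the set of non-collinear points, $n(B)$ its cardinality, $m(B)$ the number of zeros of the rational function $\mathscr M_B$ in $\mathbb{C}$ counted with multiplicities, and $\mathcal T(B)$ the number of polar roots, counted with multiplicities, that climb over $B$.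 **Statement.** For every bar $B$ of finite height, if $$\sum_{z_k\in N(B)}\Delta_B(z_k)\neq0,$$ then $\mathscr M_B$ has only finitely many zeros, only finitely many polar roots climb over $B$, and $$m(B)+1=n(B),\qquad \mathcal T(B)=\sum_{k=1}^l(p_k+q_k)-1 .$$ In particular, if $pE_2-qE_1\neq0$, then there are finitely many polar roots and their total number, counted with multiplicities, is $p+q-1$. -/

import Mathlib

open Filter Topology

noncomputable section

/-- Formal power series `F(x, y)` over `ℂ`; the variable `x` has index `0`, the variable `y` has
index `1`. -/
abbrev Ser2 : Type := MvPowerSeries (Fin 2) ℂ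

namespace Ser2

/-- The coefficient of `x ^ i * y ^ j`. -/
def coeffXY (i j : ℕ) (F : Ser2) : ℂ :=
  MvPowerSeries.coeff (Finsupp.single 0 i + Finsupp.single 1 j) F

/-- `F` belongs to `ℂ{x, y}`, i.e. it is the Taylor series of a holomorphic germ at the origin:
the double series converges (absolutely) at all points of a neighbourhood of the origin. -/
def IsConvergent (F : Ser2) : Prop :=
  ∀ᶠ p : ℂ × ℂ in 𝓝 0, Summable fun n : ℕ × ℕ => coeffXY n.1 n.2 F * p.1 ^ n.1 * p.2 ^ n.2

/-- `∂F/∂x`. -/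
def dx (F : Ser2) : Ser2 := MvPowerSeries.pderiv ℂ 0 F

/-- `∂F/∂y`. -/
def dy (F : Ser2) : Ser2 := MvPowerSeries.pderiv ℂ 1 F

/-- The Jacobian determinant `J = f_y g_x - f_x g_y`. -/
def jac (f g : Ser2) : Ser2 := dy f * dx g - dx f * dy g

/-- The exponent `E` in `F = y ^ E * F₁` with `F₁` not divisible by `y`. -/
def yExp (F : Ser2) : ℕ := multiplicity (MvPowerSeries.X 1 : Ser2) F

end Ser2

/-- Series `ξ(y) = ∑ c_e y ^ e` with rational exponents `e` and complex coefficients. -/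
abbrev QSer : Type := HahnSeries ℚ ℂ

namespace QSer

/-- `ξ` is a fractional power series (an arc) with `O_y(ξ) > 0`: the exponents are positive and
have a common denominator. -/
def IsArc (ξ : QSer) : Prop :=
  0 < ξ.orderTop ∧ ∃ D : ℕ, 0 < D ∧ ∀ e ∈ ξ.support, ∃ n : ℕ, (D : ℚ) * e = n

end QSer

namespace Ser2

/-- The substitution `F(ξ(y), y) = ∑ a_ij ξ ^ i y ^ j`, for `O_y(ξ) > 0`. -/
def subst (F : Ser2) (ξ : QSer) : QSer :=
  (HahnSeries.SummableFamily.smulFamily (fun n : ℕ × ℕ => coeffXY n.1 n.2 F)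
    ((HahnSeries.SummableFamily.powers ξ).mul
      (HahnSeries.SummableFamily.powers (HahnSeries.single (1 : ℚ) (1 : ℂ))))).hsum

/-- The Newton-Puiseux roots `x = ξ(y)`, `O_y(ξ) > 0`, of `F`. -/
def roots (F : Ser2) : Set QSer := {ξ | ξ.IsArc ∧ subst F ξ = 0}

/-- The multiplicity of `x = ξ(y)` as a root of `F`: the least `k` such that the `k`-th derivative
of `F` with respect to `x` does not vanish along `ξ`. -/
def rootMult (F : Ser2) (ξ : QSer) : ℕ := sInf {k : ℕ | subst (dx^[k] F) ξ ≠ 0}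

/-- The number of Newton-Puiseux roots of `F` that lie in `S`, counted with multiplicities. -/
def rootCount (F : Ser2) (S : Set QSer) : ℕ := ∑ᶠ ξ ∈ roots F ∩ S, rootMult F ξ

end Ser2

open Ser2

/-- The roots `λ_1, …, λ_N` of `f * g` are simple. -/
def HasSimpleRoots (f g : Ser2) : Prop := ∀ ξ ∈ roots (f * g), rootMult (f * g) ξ = 1

/-- The polar roots of the pair: the Newton-Puiseux roots `γ` of the Jacobian determinant with
`f(γ(y), y) * g(γ(y), y) ≠ 0`. -/
def polarRoots (f g : Ser2) : Set QSer :=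
  {γ | γ ∈ roots (jac f g) ∧ subst f γ * subst g γ ≠ 0}

/-- The height of the bar on top of a trunk with set of roots `T` is the finite number `h`:
`h` is the least contact order `O_y(λ - μ)` of two roots in `T`
(the contact order of a root with itself being infinite). -/
def IsTopHeight (T : Set QSer) (h : ℚ) : Prop :=
  IsLeast {o : WithTop ℚ | ∃ l ∈ T, ∃ m ∈ T, o = (l - m).orderTop} (h : WithTop ℚ)

/-- The trunks of the tree model `T(f, g)`, each given by the set of roots bundled in it.
The main trunk contains all roots of `f * g`; the trunks that grow on the bar of finite height `h`
on top of a trunk `T` are the equivalence classes of `T` modulo `h⁺`. -/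
inductive IsTrunk (f g : Ser2) : Set QSer → Prop
  | main : IsTrunk f g (roots (f * g))
  | grow (T : Set QSer) (h : ℚ) (l : QSer) (hT : IsTrunk f g T) (hh : IsTopHeight T h)
      (hl : l ∈ T) : IsTrunk f g {m | m ∈ T ∧ (h : WithTop ℚ) < (l - m).orderTop}

/-- The data of a bar `B` of finite height: its height `h(B)` and the series `λ_B`. -/
structure Bar where
  height : ℚ
  stem : QSer

namespace Bar

/-- The ground bar `B_*`. -/
def ground : Bar := ⟨0, 0⟩

/-- `B` is a bar of finite height of `T(f, g)`: the ground bar, or the bar on top of some trunk,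
where `λ_B` is obtained from any root in the trunk by omitting all terms `y ^ e`, `e ≥ h(B)`. -/
def IsBarOf (f g : Ser2) (B : Bar) : Prop :=
  B = ground ∨ ∃ T : Set QSer, IsTrunk f g T ∧ IsTopHeight T B.height ∧
    ∃ l ∈ T, B.stem = HahnSeries.truncLT B.height l

/-- The arc `λ_B(y) + z y ^ h(B)`. -/
def arc (B : Bar) (z : ℂ) : QSer := B.stem + HahnSeries.single B.height z

/-- `ξ` climbs over `B` at `a`: `ξ(y) = λ_B(y) + a y ^ h(B) + ⋯`. -/
def ClimbsAt (B : Bar) (ξ : QSer) (a : ℂ) : Prop :=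
  (B.height : WithTop ℚ) < (ξ - B.arc a).orderTop

/-- `ν_F(B)`, the order in `y` of `F(λ_B(y) + z y ^ h(B), y)` for generic `z`. On the ground bar
this is the order in `y` of `F(z, y)` for a generic small constant `z`, that is, the exponent of
`y` in `F`. -/
def nu (F : Ser2) (B : Bar) : ℚ :=
  if B.height = 0 then (yExp F : ℚ)
  else Classical.epsilon fun n : ℚ =>
    ∀ᶠ z : ℂ in cofinite, (subst F (B.arc z)).orderTop = (n : WithTop ℚ)

/-- The number of roots of `F` that climb over `B` at `c`. For `F = f` and `F = g` these are the
two entries of the bimultiplicity of the trunk that grows on `B` at `c`. -/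
def mult (F : Ser2) (B : Bar) (c : ℂ) : ℕ := rootCount F {ξ | B.ClimbsAt ξ c}

/-- The points `z_1, …, z_l` of `B` at which the trunks on `B` grow. -/
def points (f g : Ser2) (B : Bar) : Set ℂ := {c | ∃ l ∈ roots (f * g), B.ClimbsAt l c}

/-- `Δ_B(c)`, the determinant with rows `(ν_f(B), p_k)` and `(ν_g(B), q_k)` for `c = z_k`. -/
def Delta (f g : Ser2) (B : Bar) (c : ℂ) : ℚ :=
  Matrix.det !![nu f B, (mult f B c : ℚ); nu g B, (mult g B c : ℚ)]

/-- `N(B)`, the set of non-collinear points on `B`. -/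
def nonCollinear (f g : Ser2) (B : Bar) : Set ℂ := {c | c ∈ B.points f g ∧ B.Delta f g c ≠ 0}

/-- `n(B)`. -/
def n (f g : Ser2) (B : Bar) : ℕ := (B.nonCollinear f g).ncard

/-- The rational function `∑ Δ_B(z_k) / (z - z_k)` associated to `B`. -/
def ratFun (f g : Ser2) (B : Bar) : RatFunc ℂ :=
  ∑ᶠ c ∈ B.points f g, RatFunc.C ((B.Delta f g c : ℚ) : ℂ) / (RatFunc.X - RatFunc.C c)

/-- `M(B)`, the set of mero-zeros: the zeros in `ℂ` of the rational function associated to `B`,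
that is, of its numerator in lowest terms. -/
def meroZeros (f g : Ser2) (B : Bar) : Set ℂ := {z | (B.ratFun f g).num.IsRoot z}

/-- `m(B)`, the number of mero-zeros, counted with multiplicities. -/
def m (f g : Ser2) (B : Bar) : ℕ :=
  ∑ᶠ z ∈ B.meroZeros f g, (B.ratFun f g).num.rootMultiplicity z

/-- The polar roots that climb over `B`. -/
def polarOver (f g : Ser2) (B : Bar) : Set QSer :=
  {γ | γ ∈ polarRoots f g ∧ ∃ a : ℂ, B.ClimbsAt γ a}

end Bar

end

noncomputable section

/-! ### Weierstrass preparation and Newton-Puiseux splitting over `ℂ⟦X⟧`. -/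

namespace NewtonPuiseux

open Polynomial hiding constantCoeff expand
open PowerSeries (constantCoeff expand)

/-! Substitute the arcs `ξ_z = λ_B + z y ^ h(B)` into a series `F`. By the Newton-Puiseux
factorization `F = y ^ E · unit · ∏ (x - γ)`, the result is `W_F(z) y ^ ν_F + ⋯` with a nonzero
polynomial `W_F`. Only the roots `γ` that climb over `B` contribute a factor of positive degree, so
`deg W_F` is the number of roots of `F` over `B`. Likewise `F_x(ξ_z, y)` is `W_F'(z) y ^ (ν_F - h) +
⋯`. This is `Bar.exists_hasInitial`.

The chain rule for `y d/dy` along an arc (`y_mul_subst_jac`) expresses `y J` through `f`, `g`,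
`f_x`, `g_x`. Its term of exponent `ν_f + ν_g - h` is therefore `ν_f W_f W_g' - ν_g W_f' W_g`. In
degree `deg W_f + deg W_g - 1` this polynomial has the coefficient `(ν_f deg W_g - ν_g deg W_f)`
times the two leading coefficients, and the bracket equals the sum of the `Δ_B(z_k)`. If the sum is
nonzero, the polynomial is nonzero of exactly that degree, hence it is the initial polynomial of `y
J`, and its degree counts the roots of `J` over `B` (`Bar.HasInitial.jac`).

Roots of `J` and polar roots coincide: along a simple root of `f g` the same chain rule shows that
`J` does not vanish (`polarRoots_eq`).

On the ground bar the arcs `x = z` have order zero and cannot be substituted. They are replaced by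
arcs `z y ^ d` with `d > 0` below the orders of all roots. There `ν_F = E + d · #roots`, and the
terms in `d` cancel from the determinant (`Bar.rootCount_jac`).

The count of mero-zeros is separate: over the common denominator of the non-collinear poles, the
numerator of `M_B` is coprime to the denominator and has degree `n(B) - 1`, with leading coefficient
the sum of the `Δ_B(z_k)` (`RatFunc.num_sum_simple_poles`). -/

instance isAdicComplete_maximalIdeal :
    IsAdicComplete (IsLocalRing.maximalIdeal (PowerSeries ℂ)) (PowerSeries ℂ) := by
  rw [PowerSeries.maximalIdeal_eq_span_X]
  infer_instance

/-- A Weierstrass polynomial over `ℂ⟦X⟧`: monic, with all lower coefficients divisible by `X`. -/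
def IsWeierstrass (P : Polynomial (PowerSeries ℂ)) : Prop :=
  P.Monic ∧ P.map (constantCoeff (R := ℂ)) = X ^ P.natDegree

theorem mem_maximalIdeal_iff (a : PowerSeries ℂ) :
    a ∈ IsLocalRing.maximalIdeal (PowerSeries ℂ) ↔ constantCoeff a = 0 := by
  rw [PowerSeries.maximalIdeal_eq_span_X, Ideal.mem_span_singleton, PowerSeries.X_dvd_iff]

theorem map_residue_ne_zero {G : PowerSeries (PowerSeries ℂ)}
    (hG : PowerSeries.map (constantCoeff (R := ℂ)) G ≠ 0) :
    PowerSeries.map (IsLocalRing.residue (PowerSeries ℂ)) G ≠ 0 := by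
  contrapose! hG
  ext n
  have h := congrArg (PowerSeries.coeff n) hG
  rw [PowerSeries.coeff_map, map_zero, IsLocalRing.residue_eq_zero_iff, mem_maximalIdeal_iff] at h
  rw [PowerSeries.coeff_map, h, map_zero]

theorem IsWeierstrass.isDistinguishedAt {P : Polynomial (PowerSeries ℂ)} (hP : IsWeierstrass P) :
    P.IsDistinguishedAt (IsLocalRing.maximalIdeal (PowerSeries ℂ)) := by
  refine ⟨⟨fun {n} hn => ?_⟩, hP.1⟩
  have h := congrArg (fun q => q.coeff n) hP.2
  rw [mem_maximalIdeal_iff]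
  simpa [Polynomial.coeff_X_pow, hn.ne] using h

/-- Weierstrass preparation over `ℂ⟦X⟧`. -/
theorem exists_weierstrass {G : PowerSeries (PowerSeries ℂ)}
    (hG : PowerSeries.map (constantCoeff (R := ℂ)) G ≠ 0) :
    ∃ (P : Polynomial (PowerSeries ℂ)) (U : PowerSeries (PowerSeries ℂ)),
      IsWeierstrass P ∧ IsUnit U ∧ G = (P : PowerSeries (PowerSeries ℂ)) * U ∧
      constantCoeff (PowerSeries.coeff P.natDegree G) ≠ 0 ∧
      ∀ i < P.natDegree, constantCoeff (PowerSeries.coeff i G) = 0 := by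
  obtain ⟨P, U, hPU⟩ := PowerSeries.exists_isWeierstrassFactorization (map_residue_ne_zero hG)
  have hP : P.map (constantCoeff (R := ℂ)) = X ^ P.natDegree := by
    ext n
    rw [Polynomial.coeff_map, Polynomial.coeff_X_pow]
    rcases lt_trichotomy n P.natDegree with h | h | h
    · rw [if_neg h.ne]
      exact (mem_maximalIdeal_iff _).1 (hPU.isDistinguishedAt.mem h)
    · rw [if_pos h, h, hPU.isDistinguishedAt.monic.coeff_natDegree, map_one]
    · rw [if_neg h.ne', Polynomial.coeff_eq_zero_of_natDegree_lt h, map_zero]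
  have hmap : PowerSeries.map (constantCoeff (R := ℂ)) G =
      PowerSeries.map (constantCoeff (R := ℂ)) U * PowerSeries.X ^ P.natDegree := by
    rw [hPU.eq_mul, map_mul, mul_comm, ← Polynomial.polynomial_map_coe, hP]
    simp
  have hcoeff : ∀ i, constantCoeff (PowerSeries.coeff i G) =
      PowerSeries.coeff i (PowerSeries.map (constantCoeff (R := ℂ)) U *
        PowerSeries.X ^ P.natDegree) := by
    intro i
    rw [← hmap, PowerSeries.coeff_map]
  refine ⟨P, U, ⟨hPU.isDistinguishedAt.monic, hP⟩, hPU.isUnit, hPU.eq_mul, ?_, ?_⟩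
  · rw [hcoeff, PowerSeries.coeff_mul_X_pow', if_pos le_rfl, Nat.sub_self]
    have := ((hPU.isUnit.map (PowerSeries.map (constantCoeff (R := ℂ)))).map
      (constantCoeff (R := ℂ)))
    rw [PowerSeries.coeff_zero_eq_constantCoeff_apply]
    exact this.ne_zero
  · intro i hi
    rw [hcoeff, PowerSeries.coeff_mul_X_pow', if_neg (by omega)]

/-- Uniqueness of Weierstrass division: subtracting `Q = P * U` from the Euclidean division of `Q`
by the monic `P` gives a Weierstrass division of `0`, whose remainder must vanish. Thus divisibility
among power series descends to polynomials. -/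
theorem dvd_of_coe_eq_mul {P Q : Polynomial (PowerSeries ℂ)} {U : PowerSeries (PowerSeries ℂ)}
    (hP : IsWeierstrass P) (h : (Q : PowerSeries (PowerSeries ℂ)) = P * U) : P ∣ Q := by
  have hne : PowerSeries.map (IsLocalRing.residue (PowerSeries ℂ))
      (P : PowerSeries (PowerSeries ℂ)) ≠ 0 := by
    apply map_residue_ne_zero
    rw [← Polynomial.polynomial_map_coe, hP.2]
    simp
  have hdiv : (Q : PowerSeries (PowerSeries ℂ)) =
      (P : PowerSeries (PowerSeries ℂ)) * ((Q /ₘ P : Polynomial (PowerSeries ℂ)) :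
        PowerSeries (PowerSeries ℂ)) + ((Q %ₘ P : Polynomial (PowerSeries ℂ)) :
        PowerSeries (PowerSeries ℂ)) := by
    rw [← Polynomial.coe_mul, ← Polynomial.coe_add, add_comm, Polynomial.modByMonic_add_div]
  have hord : (PowerSeries.map (IsLocalRing.residue (PowerSeries ℂ))
      (P : PowerSeries (PowerSeries ℂ))).order.toNat = P.natDegree := by
    have h1 : PowerSeries.IsWeierstrassFactorization (P : PowerSeries (PowerSeries ℂ)) P 1 :=
      ⟨hP.isDistinguishedAt, isUnit_one, by simp⟩
    exact h1.natDegree_eq_toNat_order_map.symm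
  have hW : PowerSeries.IsWeierstrassDivision (0 : PowerSeries (PowerSeries ℂ))
      (P : PowerSeries (PowerSeries ℂ))
      (((Q /ₘ P : Polynomial (PowerSeries ℂ)) : PowerSeries (PowerSeries ℂ)) - U) (Q %ₘ P) := by
    constructor
    · change _ < (((PowerSeries.map (IsLocalRing.residue (PowerSeries ℂ))
        (P : PowerSeries (PowerSeries ℂ))).order.toNat : ℕ) : WithBot ℕ)
      rw [hord, ← Polynomial.degree_eq_natDegree hP.1.ne_zero]
      exact Polynomial.degree_modByMonic_lt _ hP.1
    · rw [mul_sub, ← h, hdiv]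
      ring
  exact (Polynomial.modByMonic_eq_zero_iff_dvd hP.1).1
    (PowerSeries.IsWeierstrassDivision.eq_zero hne hW).2

theorem constantCoeff_expand' (D : ℕ) (hD : D ≠ 0) :
    (constantCoeff (R := ℂ)).comp (expand D hD : PowerSeries ℂ →ₐ[ℂ] PowerSeries ℂ).toRingHom =
      constantCoeff (R := ℂ) := by
  ext a
  exact PowerSeries.constantCoeff_expand D hD a

/-- `P` acquires a root of positive order after the base change `X ↦ X ^ D`. -/
def HasPuiseuxRoot (P : Polynomial (PowerSeries ℂ)) : Prop :=
  ∃ (D : ℕ) (hD : D ≠ 0) (η : PowerSeries ℂ), constantCoeff η = 0 ∧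
    P.eval₂ (expand D hD : PowerSeries ℂ →ₐ[ℂ] PowerSeries ℂ).toRingHom η = 0

theorem HasPuiseuxRoot.of_taylor {P : Polynomial (PowerSeries ℂ)} {b : PowerSeries ℂ}
    (hb : constantCoeff b = 0) (h : HasPuiseuxRoot (taylor b P)) : HasPuiseuxRoot P := by
  obtain ⟨D, hD, η, hη, h⟩ := h
  refine ⟨D, hD, η + expand D hD b, ?_, ?_⟩
  · rw [map_add, hη, PowerSeries.constantCoeff_expand, hb, add_zero]
  · rw [taylor_apply, eval₂_comp] at h
    simpa using h

theorem coeff_taylor_pred {P : Polynomial (PowerSeries ℂ)} (hP : P.Monic) {d : ℕ}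
    (hd : P.natDegree = d + 1) (b : PowerSeries ℂ) :
    (taylor b P).coeff d = P.coeff d + (d + 1 : ℕ) * b := by
  rw [taylor_coeff, eval_eq_sum_range' (n := 2)]
  · rw [Finset.sum_range_succ, Finset.sum_range_one, hasseDeriv_coeff, hasseDeriv_coeff]
    have h1 : P.coeff (1 + d) = 1 := by rw [add_comm, ← hd]; exact hP
    rw [h1, zero_add, Nat.choose_self, add_comm 1 d, Nat.choose_succ_self_right]
    simp
  · have := natDegree_hasseDeriv_le P d
    omega

/-- A monic polynomial without subleading term, other than `X ^ d`, has no `d`-fold root. -/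
theorem exists_coeff_taylor_ne_zero {Q : Polynomial ℂ} (hQ : Q.Monic) {d : ℕ}
    (hd : Q.natDegree = d + 1) (hQd : Q.coeff d = 0) (hne : Q ≠ X ^ (d + 1)) (c : ℂ) :
    ∃ i < d + 1, (taylor c Q).coeff i ≠ 0 := by
  by_contra! h
  have h1 : taylor c Q = X ^ (d + 1) := by
    ext n
    rw [coeff_X_pow]
    rcases lt_trichotomy n (d + 1) with hn | hn | hn
    · rw [if_neg hn.ne, h n hn]
    · have hm : (taylor c Q).Monic := by rw [taylor_apply]; exact hQ.comp_X_add_C c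
      rw [if_pos hn, hn, ← hd, ← natDegree_taylor Q c]
      exact hm
    · rw [if_neg hn.ne', coeff_eq_zero_of_natDegree_lt]
      rw [natDegree_taylor]
      omega
  have h2 : Q = (X - C c) ^ (d + 1) := by
    have := congrArg (taylor (-c)) h1
    rw [taylor_taylor] at this
    simpa [sub_eq_add_neg] using this
  -- The coefficient of degree `d` of `(X - c) ^ (d + 1)` is `-(d + 1) c`, and it vanishes by
  -- assumption.
  have h3 : c = 0 := by
    rw [h2, sub_eq_add_neg, ← C_neg, coeff_X_add_C_pow] at hQd
    have : ((d : ℂ) + 1) ≠ 0 := by exact_mod_cast d.succ_ne_zero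
    simpa [this] using hQd
  rw [h3] at h2
  exact hne (by simpa using h2)

theorem X_pow_dvd_expand {r : ℕ} (hr : r ≠ 0) {a : PowerSeries ℂ} {k : ℕ}
    (h : (k : ℕ∞) ≤ r • a.order) : (PowerSeries.X : PowerSeries ℂ) ^ k ∣ expand r hr a := by
  rw [PowerSeries.X_pow_dvd_iff]
  intro m hm
  apply PowerSeries.coeff_of_lt_order
  rw [PowerSeries.order_expand]
  exact lt_of_lt_of_le (by exact_mod_cast hm) h

/-- The Newton polygon step: after a base change the polynomial is, up to a dilation, a monic
polynomial whose reduction is not a power of `X`. -/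
theorem exists_scaleRoots {P : Polynomial (PowerSeries ℂ)} (hP : IsWeierstrass P)
    (hne : P ≠ X ^ P.natDegree) :
    ∃ (r : ℕ) (hr : r ≠ 0) (m : ℕ) (R : Polynomial (PowerSeries ℂ)), m ≠ 0 ∧ R.Monic ∧
      R.natDegree = P.natDegree ∧
      R.map (constantCoeff (R := ℂ)) ≠ X ^ P.natDegree ∧
      (∀ i, P.coeff i = 0 → R.coeff i = 0) ∧
      P.map (expand r hr : PowerSeries ℂ →ₐ[ℂ] PowerSeries ℂ).toRingHom =
        R.scaleRoots (PowerSeries.X ^ m) := by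
  classical
  set d := P.natDegree with hd
  let S := (Finset.range d).filter fun i => P.coeff i ≠ 0
  have hS : S.Nonempty := by
    by_contra! hS
    apply hne
    ext1 n
    rw [coeff_X_pow]
    rcases lt_trichotomy n d with hn | hn | hn
    · rw [if_neg hn.ne]
      by_contra h
      have : n ∈ S := by simp [S, hn, h]
      simp [hS] at this
    · rw [if_pos hn, hn]; exact hP.1
    · rw [if_neg hn.ne', coeff_eq_zero_of_natDegree_lt hn]
  let o : ℕ → ℕ := fun i => (P.coeff i).order.toNat
  -- The least slope `o i / (d - i)` of the Newton polygon. After `X ↦ X ^ (d - i₀)`, the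
  -- coefficient of index `i` is divisible by `X ^ (o i₀ * (d - i))`, with equality of orders at
  -- `i₀`; hence `r = d - i₀` and `m = o i₀`.
  obtain ⟨i₀, hi₀, hmin⟩ := S.exists_min_image (fun i => (o i : ℚ) / ((d - i : ℕ) : ℚ)) hS
  simp only [S, Finset.mem_filter, Finset.mem_range] at hi₀ hmin
  obtain ⟨hi₀d, hi₀⟩ := hi₀
  have hr : d - i₀ ≠ 0 := by omega
  have hord : ∀ i, P.coeff i ≠ 0 → (P.coeff i).order = (o i : ℕ∞) := fun i hi =>
    (ENat.natCast_toNat (by simpa [PowerSeries.order_eq_top] using hi)).symm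
  have hle : ∀ i < d, P.coeff i ≠ 0 → o i₀ * (d - i) ≤ (d - i₀) * o i := by
    intro i hi hi'
    have h := hmin i ⟨hi, hi'⟩
    rw [div_le_div_iff₀ (by exact_mod_cast Nat.pos_of_ne_zero hr)
      (by exact_mod_cast Nat.sub_pos_of_lt hi)] at h
    have h' : o i₀ * (d - i) ≤ o i * (d - i₀) := by exact_mod_cast h
    rwa [mul_comm (d - i₀)]
  have hdvd : ∀ i, ∃ b : PowerSeries ℂ, expand (d - i₀) hr (P.coeff i) =
      b * PowerSeries.X ^ (o i₀ * (d - i)) ∧ (P.coeff i = 0 → b = 0) := by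
    intro i
    by_cases hi : P.coeff i = 0
    · exact ⟨0, by simp [hi], fun _ => rfl⟩
    · have hid : i ≤ d := le_natDegree_of_ne_zero hi
      have : (PowerSeries.X : PowerSeries ℂ) ^ (o i₀ * (d - i)) ∣
          expand (d - i₀) hr (P.coeff i) := by
        apply X_pow_dvd_expand
        rcases hid.lt_or_eq with h | h
        · rw [hord i hi, nsmul_eq_mul]
          exact_mod_cast hle i h hi
        · simp [h]
      obtain ⟨b, hb⟩ := this
      exact ⟨b, by rw [hb, mul_comm], fun h => absurd h hi⟩
  choose b hb hb0 using hdvd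
  have hbd : b d = 1 := by
    have := hb d
    rw [show P.coeff d = 1 from hP.1] at this
    simpa using this.symm
  -- The minimum is attained at `i₀`, so nothing of positive order is left there; this keeps the
  -- reduction of `R` from being a power of `X`.
  have hbi₀ : constantCoeff (b i₀) ≠ 0 := by
    intro h
    have h1 := hb i₀
    obtain ⟨c, hc⟩ := PowerSeries.X_dvd_iff.2 h
    have h2 : PowerSeries.coeff (o i₀ * (d - i₀)) (expand (d - i₀) hr (P.coeff i₀)) = 0 := by
      rw [h1, hc, PowerSeries.coeff_mul_X_pow']
      simp
    rw [mul_comm, PowerSeries.coeff_expand_mul] at h2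
    exact PowerSeries.coeff_order (by simpa [PowerSeries.order_eq_top] using hi₀) h2
  have hm : o i₀ ≠ 0 := by
    intro h
    have h1 : constantCoeff (P.coeff i₀) = 0 :=
      (mem_maximalIdeal_iff _).1 (hP.isDistinguishedAt.mem hi₀d)
    have h2 := PowerSeries.coeff_order (φ := P.coeff i₀)
      (by simpa [PowerSeries.order_eq_top] using hi₀)
    change PowerSeries.coeff (o i₀) _ ≠ 0 at h2
    rw [h, PowerSeries.coeff_zero_eq_constantCoeff_apply] at h2
    exact h2 h1
  let R : Polynomial (PowerSeries ℂ) := ∑ i ∈ Finset.range (d + 1), monomial i (b i)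
  have hR : ∀ i, R.coeff i = if i ≤ d then b i else 0 := by
    intro i
    simp [R, finsetSum_coeff, coeff_monomial]
  have hRdeg : R.natDegree = d := by
    apply natDegree_eq_of_le_of_coeff_ne_zero
    · rw [natDegree_le_iff_coeff_eq_zero]
      intro n hn
      rw [hR, if_neg (by omega)]
    · rw [hR, if_pos le_rfl, hbd]
      exact one_ne_zero
  refine ⟨d - i₀, hr, o i₀, R, hm, ?_, hRdeg, ?_, ?_, ?_⟩
  · rw [Monic, leadingCoeff, hRdeg, hR, if_pos le_rfl, hbd]
  · intro h
    have := congrArg (fun q => q.coeff i₀) h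
    simp only [coeff_map, coeff_X_pow, if_neg hi₀d.ne, hR, if_pos hi₀d.le] at this
    exact hbi₀ this
  · intro i hi
    rw [hR, hb0 i hi, ite_self]
  · ext1 i
    rw [coeff_map, coeff_scaleRoots, hRdeg, hR]
    change expand (d - i₀) hr (P.coeff i) = _
    split_ifs with h
    · rw [hb, pow_mul]
    · rw [coeff_eq_zero_of_natDegree_lt (by omega), map_zero, zero_mul]

theorem IsWeierstrass.taylor {P : Polynomial (PowerSeries ℂ)} (hP : IsWeierstrass P)
    {b : PowerSeries ℂ} (hb : constantCoeff b = 0) : IsWeierstrass (taylor b P) := by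
  refine ⟨by rw [taylor_apply]; exact hP.1.comp_X_add_C b, ?_⟩
  rw [natDegree_taylor, taylor_apply, Polynomial.map_comp, hP.2]
  simp [hb]

theorem taylor_map (R : Polynomial (PowerSeries ℂ)) (c : PowerSeries ℂ) :
    (taylor c R).map (constantCoeff (R := ℂ)) =
      taylor (constantCoeff c) (R.map (constantCoeff (R := ℂ))) := by
  rw [taylor_apply, taylor_apply, Polynomial.map_comp]
  simp

/-- Induction on the degree. Once the subleading coefficient is removed, the reduction after the
Newton polygon step has only roots of multiplicity less than the degree, so Weierstrass preparation
at such a root splits off a factor of smaller degree. -/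
theorem hasPuiseuxRoot (d : ℕ) : ∀ P : Polynomial (PowerSeries ℂ), IsWeierstrass P →
    P.natDegree = d + 1 → HasPuiseuxRoot P := by
  induction d using Nat.strong_induction_on with
  | _ d ih =>
  intro P hP hd
  -- Tschirnhaus translation: this `b` cancels the coefficient of degree `d`.
  set b : PowerSeries ℂ := - (PowerSeries.C ((d + 1 : ℂ)⁻¹) * P.coeff d) with hbdef
  have hb : constantCoeff b = 0 := by
    have : constantCoeff (P.coeff d) = 0 :=
      (mem_maximalIdeal_iff _).1 (hP.isDistinguishedAt.mem (by omega))
    simp [hbdef, this]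
  apply HasPuiseuxRoot.of_taylor hb
  have hP₁ := hP.taylor hb
  have hd₁ : (taylor b P).natDegree = d + 1 := by rw [natDegree_taylor, hd]
  have hcoeff : (taylor b P).coeff d = 0 := by
    rw [coeff_taylor_pred hP.1 hd, hbdef]
    have h1 : ((d + 1 : ℕ) : PowerSeries ℂ) = PowerSeries.C ((d : ℂ) + 1) := by simp
    have h2 : ((d : ℂ) + 1) ≠ 0 := by exact_mod_cast d.succ_ne_zero
    rw [h1, mul_neg, ← mul_assoc, ← map_mul, mul_inv_cancel₀ h2, map_one, one_mul, add_neg_cancel]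
  generalize taylor b P = P₁ at hP₁ hd₁ hcoeff
  by_cases hX : P₁ = X ^ P₁.natDegree
  · exact ⟨1, one_ne_zero, 0, map_zero _, by rw [hX, hd₁]; simp⟩
  obtain ⟨r, hr, m, R, hm, hRm, hRd, hRX, hR0, hRP⟩ := exists_scaleRoots hP₁ hX
  rw [hd₁] at hRd hRX
  set Q := R.map (constantCoeff (R := ℂ)) with hQdef
  have hQm : Q.Monic := hRm.map _
  have hQd : Q.natDegree = d + 1 := by rw [hQdef, hRm.natDegree_map, hRd]
  obtain ⟨c, hc⟩ := IsAlgClosed.exists_root Q (by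
    rw [degree_eq_natDegree hQm.ne_zero, hQd]
    exact_mod_cast d.succ_ne_zero)
  have hQc : Q.coeff d = 0 := by rw [hQdef, coeff_map, hR0 d hcoeff, map_zero]
  obtain ⟨i, hi, hine⟩ := exists_coeff_taylor_ne_zero hQm hQd hQc hRX c
  have hTQ : (taylor (PowerSeries.C c) R).map (constantCoeff (R := ℂ)) = taylor c Q := by
    rw [taylor_map]; simp [hQdef]
  have hcT : ∀ j, constantCoeff (PowerSeries.coeff j
      ((taylor (PowerSeries.C c) R : Polynomial (PowerSeries ℂ)) : PowerSeries (PowerSeries ℂ))) =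
      (taylor c Q).coeff j := by
    intro j
    rw [coeff_coe, ← hTQ, coeff_map]
  -- The degree of `P₂` is the multiplicity of `c` as a root of `Q`: positive since `c` is a root,
  -- and less than `d + 1` by the choice of `i`.
  obtain ⟨P₂, U, hP₂, hU, hfac, hne, hzero⟩ := exists_weierstrass
    (G := ((taylor (PowerSeries.C c) R : Polynomial (PowerSeries ℂ)) :
      PowerSeries (PowerSeries ℂ))) (by
      intro h
      apply hine
      rw [← hcT, ← PowerSeries.coeff_map, h, map_zero])
  rw [hcT] at hne
  have hlt : P₂.natDegree < d + 1 := by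
    by_contra h
    exact hine (by rw [← hcT, hzero i (by omega)])
  have hpos : P₂.natDegree ≠ 0 := by
    intro h
    rw [h, taylor_coeff_zero] at hne
    exact hne hc
  obtain ⟨D, hD, η, hη, hroot⟩ := ih (P₂.natDegree - 1) (by omega) P₂ hP₂ (by omega)
  obtain ⟨K, hK⟩ := dvd_of_coe_eq_mul hP₂ hfac
  have hroot' : R.eval₂ (expand D hD : PowerSeries ℂ →ₐ[ℂ] PowerSeries ℂ).toRingHom
      (η + PowerSeries.C c) = 0 := by
    have h : (taylor (PowerSeries.C c) R).eval₂
        (expand D hD : PowerSeries ℂ →ₐ[ℂ] PowerSeries ℂ).toRingHom η = 0 := by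
      rw [hK, eval₂_mul, hroot, zero_mul]
    rw [taylor_apply, eval₂_comp] at h
    simpa [PowerSeries.expand_C] using h
  -- The two base changes compose, and the dilation of the roots by `X ^ m` is undone.
  refine ⟨D * r, mul_ne_zero hD hr, expand D hD (PowerSeries.X ^ m) * (η + PowerSeries.C c), ?_, ?_⟩
  · simp [hm, hD]
  · have hcomp : (expand (D * r) (mul_ne_zero hD hr) :
        PowerSeries ℂ →ₐ[ℂ] PowerSeries ℂ).toRingHom =
        (expand D hD : PowerSeries ℂ →ₐ[ℂ] PowerSeries ℂ).toRingHom.comp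
          (expand r hr : PowerSeries ℂ →ₐ[ℂ] PowerSeries ℂ).toRingHom := by
      rw [PowerSeries.expand_mul_eq_comp _ _ _ hr]
      rfl
    rw [hcomp, ← eval₂_map, hRP]
    have := scaleRoots_eval₂_mul (p := R)
      (expand D hD : PowerSeries ℂ →ₐ[ℂ] PowerSeries ℂ).toRingHom (η + PowerSeries.C c)
      (PowerSeries.X ^ m)
    rw [hroot', mul_zero] at this
    exact this

/-- **Newton-Puiseux**: a Weierstrass polynomial splits after a base change `X ↦ X ^ D`. -/
theorem exists_splitting (d : ℕ) : ∀ P : Polynomial (PowerSeries ℂ), IsWeierstrass P →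
    P.natDegree = d → ∃ (D : ℕ) (hD : D ≠ 0) (s : Multiset (PowerSeries ℂ)),
      (∀ η ∈ s, constantCoeff η = 0) ∧
      P.map (expand D hD : PowerSeries ℂ →ₐ[ℂ] PowerSeries ℂ).toRingHom =
        (s.map fun η => X - C η).prod := by
  induction d with
  | zero =>
    intro P hP hd
    refine ⟨1, one_ne_zero, 0, by simp, ?_⟩
    rw [hP.1.natDegree_eq_zero.1 hd]
    simp
  | succ d ih =>
    intro P hP hd
    obtain ⟨D, hD, η, hη, hroot⟩ := hasPuiseuxRoot d P hP hd
    rw [← eval_map] at hroot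
    obtain ⟨Q, hQ⟩ := dvd_iff_isRoot.2 hroot
    have hPm := hP.1.map (expand D hD : PowerSeries ℂ →ₐ[ℂ] PowerSeries ℂ).toRingHom
    have hQm : Q.Monic := (monic_X_sub_C η).of_mul_monic_left (hQ ▸ hPm)
    have hQd : Q.natDegree = d := by
      have := congrArg natDegree hQ
      rw [hP.1.natDegree_map, hd, (monic_X_sub_C η).natDegree_mul hQm, natDegree_X_sub_C] at this
      omega
    have hQW : IsWeierstrass Q := by
      refine ⟨hQm, ?_⟩
      have h := congrArg (Polynomial.map (constantCoeff (R := ℂ))) hQ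
      rw [Polynomial.map_map, constantCoeff_expand', hP.2, hd, Polynomial.map_mul, pow_succ'] at h
      simp only [Polynomial.map_sub, map_X, map_C, hη, map_zero, sub_zero] at h
      rw [hQd]
      exact (mul_left_cancel₀ X_ne_zero h).symm
    obtain ⟨E, hE, s, hs, hprod⟩ := ih Q hQW hQd
    refine ⟨E * D, mul_ne_zero hE hD, expand E hE η ::ₘ s, ?_, ?_⟩
    · intro ζ hζ
      rcases Multiset.mem_cons.1 hζ with h | h
      · rw [h, PowerSeries.constantCoeff_expand, hη]
      · exact hs ζ h
    · have hcomp : (expand (E * D) (mul_ne_zero hE hD) :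
          PowerSeries ℂ →ₐ[ℂ] PowerSeries ℂ).toRingHom =
          (expand E hE : PowerSeries ℂ →ₐ[ℂ] PowerSeries ℂ).toRingHom.comp
            (expand D hD : PowerSeries ℂ →ₐ[ℂ] PowerSeries ℂ).toRingHom := by
        rw [PowerSeries.expand_mul_eq_comp _ _ _ hD]
        rfl
      rw [hcomp, ← Polynomial.map_map, hQ, Polynomial.map_mul, hprod, Multiset.map_cons,
        Multiset.prod_cons]
      simp

end NewtonPuiseux

/-! ### The derivation `y d/dy` and order estimates for fractional series. -/

namespace QSer

theorem coe_le_orderTop_iff {a : ℚ} {x : QSer} :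
    (a : WithTop ℚ) ≤ x.orderTop ↔ ∀ e < a, x.coeff e = 0 := by
  rw [HahnSeries.le_orderTop_iff_forall]
  simp

/-- The derivation `y d/dy`. -/
def euler : QSer →ₗ[ℂ] QSer where
  toFun x :=
    { coeff := fun e => (e : ℂ) * x.coeff e
      isPWO_support' := x.isPWO_support.mono fun e he h => he (by simp [h]) }
  map_add' x y := by ext e; simp [mul_add]
  map_smul' c x := by ext e; simp [mul_left_comm]

@[simp]
theorem coeff_euler (x : QSer) (e : ℚ) : (euler x).coeff e = (e : ℂ) * x.coeff e := rfl

theorem support_euler_subset (x : QSer) : (euler x).support ⊆ x.support :=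
  fun e he h => he (by simp [h])

theorem euler_mul (x y : QSer) : euler (x * y) = euler x * y + x * euler y := by
  ext e
  -- All three convolutions are written over the same pairs of exponents, where the rule becomes `e
  -- = i + j`.
  rw [HahnSeries.coeff_add, coeff_euler, HahnSeries.coeff_mul,
    HahnSeries.coeff_mul_left' x.isPWO_support (support_euler_subset x),
    HahnSeries.coeff_mul_right' y.isPWO_support (support_euler_subset y), ← Finset.sum_add_distrib,
    Finset.mul_sum]
  refine Finset.sum_congr rfl fun ij hij => ?_
  rw [Finset.mem_antidiagonal] at hij
  rw [← hij.2.2]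
  simp only [coeff_euler]
  push_cast
  ring

theorem euler_single (a : ℚ) (c : ℂ) :
    euler (HahnSeries.single a c) = HahnSeries.single a ((a : ℂ) * c) := by
  ext e
  by_cases h : e = a <;> simp [h]

theorem orderTop_le_orderTop_euler (x : QSer) : x.orderTop ≤ (euler x).orderTop := by
  rw [HahnSeries.le_orderTop_iff_forall]
  intro e he
  rw [coeff_euler, HahnSeries.coeff_eq_zero_of_lt_orderTop he, mul_zero]

/-- The kernel of `y d/dy` consists of the constants, and positive order excludes nonzero constants.
-/
theorem euler_ne_zero {x : QSer} (hx : x ≠ 0) (h : 0 < x.orderTop) : euler x ≠ 0 := by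
  intro h0
  apply hx
  ext e
  by_contra he
  have h1 := congrArg (fun z => z.coeff e) h0
  simp only [coeff_euler, HahnSeries.coeff_zero, mul_eq_zero] at h1
  rcases h1 with h1 | h1
  · have h2 : e = 0 := by exact_mod_cast h1
    rw [h2] at he
    exact he (HahnSeries.coeff_eq_zero_of_lt_orderTop h)
  · exact he h1

/-- The series `y`. -/
def y : QSer := HahnSeries.single 1 1

theorem orderTop_y_pos : 0 < y.orderTop := by
  rw [y, HahnSeries.orderTop_single one_ne_zero]
  exact_mod_cast zero_lt_one (α := ℚ)

theorem y_ne_zero : y ≠ 0 := HahnSeries.single_ne_zero one_ne_zero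

theorem exists_pos_le_orderTop {x : QSer} (hx : 0 < x.orderTop) :
    ∃ d : ℚ, 0 < d ∧ d ≤ 1 ∧ (d : WithTop ℚ) ≤ x.orderTop := by
  induction h : x.orderTop with
  | top => exact ⟨1, one_pos, le_rfl, le_top⟩
  | coe o =>
    rw [h] at hx
    have ho : 0 < o := by exact_mod_cast hx
    exact ⟨min o 1, lt_min ho one_pos, min_le_right _ _, by exact_mod_cast min_le_left _ _⟩

theorem add_le_orderTop_mul {a b : ℚ} {x z : QSer} (hx : (a : WithTop ℚ) ≤ x.orderTop)
    (hz : (b : WithTop ℚ) ≤ z.orderTop) : ((a + b : ℚ) : WithTop ℚ) ≤ (x * z).orderTop := by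
  rw [WithTop.coe_add]
  exact (add_le_add hx hz).trans HahnSeries.orderTop_add_le_mul

theorem le_orderTop_sub {a : WithTop ℚ} {x z : QSer} (hx : a ≤ x.orderTop)
    (hz : a ≤ z.orderTop) : a ≤ (x - z).orderTop :=
  (le_min hx hz).trans HahnSeries.min_orderTop_le_orderTop_sub

theorem le_orderTop_add {a : WithTop ℚ} {x z : QSer} (hx : a ≤ x.orderTop)
    (hz : a ≤ z.orderTop) : a ≤ (x + z).orderTop :=
  (le_min hx hz).trans HahnSeries.min_orderTop_le_orderTop_add

theorem le_orderTop_pow {a : ℚ} {x : QSer} (hx : (a : WithTop ℚ) ≤ x.orderTop) (n : ℕ) :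
    ((n * a : ℚ) : WithTop ℚ) ≤ (x ^ n).orderTop := by
  induction n with
  | zero => simp
  | succ n ih =>
    rw [pow_succ, Nat.cast_succ, add_one_mul]
    exact add_le_orderTop_mul ih hx

end QSer

/-! ### Substitution of arcs: ring homomorphism and chain rule. -/

namespace Ser2

open QSer

theorem coeff_subst (F : Ser2) {ξ : QSer} (hξ : 0 < ξ.orderTop) (e : ℚ) :
    (subst F ξ).coeff e = ∑ᶠ n : ℕ × ℕ, coeffXY n.1 n.2 F * (ξ ^ n.1 * y ^ n.2).coeff e := by
  rw [subst, HahnSeries.SummableFamily.hsum_smulFamily]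
  refine finsum_congr fun n => ?_
  rw [smul_eq_mul]
  change _ * (HahnSeries.SummableFamily.powers ξ n.1 *
    HahnSeries.SummableFamily.powers (HahnSeries.single (1 : ℚ) (1 : ℂ)) n.2).coeff e = _
  rw [HahnSeries.SummableFamily.powers_of_orderTop_pos hξ,
    HahnSeries.SummableFamily.powers_of_orderTop_pos (x := HahnSeries.single (1 : ℚ) (1 : ℂ))
      orderTop_y_pos]
  rfl

theorem subst_add (F G : Ser2) (ξ : QSer) : subst (F + G) ξ = subst F ξ + subst G ξ := by
  rw [subst, subst, subst, ← HahnSeries.SummableFamily.hsum_add]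
  congr 1
  ext n e
  rw [HahnSeries.SummableFamily.add_apply]
  simp only [HahnSeries.SummableFamily.smulFamily_toFun, ← add_smul]
  rw [coeffXY, map_add]
  rfl

theorem coeffXY_eq (F : Ser2) (u : Fin 2 →₀ ℕ) :
    MvPowerSeries.coeff u F = coeffXY (u 0) (u 1) F := by
  rw [coeffXY]
  congr 2
  ext i
  fin_cases i <;> simp

theorem degree_eq (u : Fin 2 →₀ ℕ) : u.degree = u 0 + u 1 := by
  rw [Finsupp.degree_eq_sum, Fin.sum_univ_two]

theorem coeffXY_of_lt_order {F : Ser2} {i j : ℕ} (h : ((i + j : ℕ) : ℕ∞) < F.order) :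
    coeffXY i j F = 0 := by
  rw [coeffXY]
  apply MvPowerSeries.coeff_of_lt_order
  rw [degree_eq]
  simpa using h

theorem le_orderTop_subst {F : Ser2} {ξ : QSer} {d : ℚ} (hd : 0 < d) (hd1 : d ≤ 1)
    (hξ : (d : WithTop ℚ) ≤ ξ.orderTop) {N : ℕ} (hN : (N : ℕ∞) ≤ F.order) :
    ((N * d : ℚ) : WithTop ℚ) ≤ (subst F ξ).orderTop := by
  have hξ0 : 0 < ξ.orderTop := lt_of_lt_of_le (by exact_mod_cast hd) hξ
  rw [coe_le_orderTop_iff]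
  intro e he
  rw [coeff_subst F hξ0]
  apply finsum_eq_zero_of_forall_eq_zero
  intro n
  by_cases hn : n.1 + n.2 < N
  · rw [coeffXY_of_lt_order (lt_of_lt_of_le (by exact_mod_cast hn) hN), zero_mul]
  · have hy : (d : WithTop ℚ) ≤ y.orderTop := by
      rw [y, HahnSeries.orderTop_single one_ne_zero]
      exact_mod_cast hd1
    have := add_le_orderTop_mul (le_orderTop_pow hξ n.1) (le_orderTop_pow hy n.2)
    rw [coe_le_orderTop_iff.1 this e, mul_zero]
    refine he.trans_le ?_
    rw [← add_mul]
    have : (N : ℚ) ≤ n.1 + n.2 := by exact_mod_cast not_lt.1 hn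
    exact mul_le_mul_of_nonneg_right this hd.le

/-- An additive map on power series that kills polynomials and is continuous is zero. -/
theorem eq_zero_of_polynomial {T : Ser2 → QSer} (hadd : ∀ F G, T (F + G) = T F + T G) {d c : ℚ}
    (hd : 0 < d) (hT : ∀ (F : Ser2) (N : ℕ), (N : ℕ∞) ≤ F.order →
      ((N * d - c : ℚ) : WithTop ℚ) ≤ (T F).orderTop)
    (hpoly : ∀ p : MvPolynomial (Fin 2) ℂ, T (p : Ser2) = 0) (F : Ser2) : T F = 0 := by
  ext e
  -- Chosen so that `N * d - c > e`: the tail of `F` of order at least `N` then has no effect on the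
  -- coefficient at `e`.
  obtain ⟨N, hN⟩ := exists_nat_gt ((e + c) / d)
  have hF : F = (MvPowerSeries.truncTotal N F : Ser2) +
      (F - (MvPowerSeries.truncTotal N F : Ser2)) := by ring
  rw [hF, hadd, hpoly, zero_add]
  refine coe_le_orderTop_iff.1 (hT _ N (MvPowerSeries.le_order fun u hu => ?_)) e ?_
  · rw [map_sub, MvPolynomial.coeff_coe,
      MvPowerSeries.coeff_truncTotal _ (by exact_mod_cast hu), sub_self]
  · rw [div_lt_iff₀ hd] at hN
    linarith

theorem coeffXY_monomial (u : Fin 2 →₀ ℕ) (a : ℂ) (n : ℕ × ℕ) :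
    coeffXY n.1 n.2 (MvPowerSeries.monomial u a) = if n = (u 0, u 1) then a else 0 := by
  classical
  rw [coeffXY, MvPowerSeries.coeff_monomial]
  refine if_congr ?_ rfl rfl
  constructor
  · rintro rfl
    ext <;> simp
  · rintro rfl
    ext i
    fin_cases i <;> simp

theorem subst_monomial (u : Fin 2 →₀ ℕ) (a : ℂ) {ξ : QSer} (hξ : 0 < ξ.orderTop) :
    subst (MvPowerSeries.monomial u a) ξ = a • (ξ ^ u 0 * y ^ u 1) := by
  ext e
  rw [coeff_subst _ hξ, finsum_eq_single _ (u 0, u 1)]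
  · rw [coeffXY_monomial u a (u 0, u 1), if_pos rfl, HahnSeries.coeff_smul, smul_eq_mul]
  · intro n hn
    rw [coeffXY_monomial, if_neg hn, zero_mul]

theorem subst_coe (p : MvPolynomial (Fin 2) ℂ) {ξ : QSer} (hξ : 0 < ξ.orderTop) :
    subst (p : Ser2) ξ = MvPolynomial.eval₂Hom HahnSeries.C ![ξ, y] p := by
  induction p using MvPolynomial.induction_on' with
  | monomial u a =>
    rw [MvPolynomial.coe_monomial, subst_monomial u a hξ, MvPolynomial.coe_eval₂Hom,
      MvPolynomial.eval₂_monomial,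
      Finsupp.prod_fintype _ _ (fun i => pow_zero _), Fin.prod_univ_two, ← HahnSeries.C_mul_eq_smul]
    rfl
  | add p q hp hq => rw [MvPolynomial.coe_add, subst_add, hp, hq, map_add]

theorem le_order_mul_left {F G : Ser2} {N : ℕ∞} (h : N ≤ F.order) : N ≤ (F * G).order :=
  (h.trans le_self_add).trans MvPowerSeries.le_order_mul

theorem orderTop_subst_nonneg (F : Ser2) {ξ : QSer} (hξ : 0 < ξ.orderTop) :
    0 ≤ (subst F ξ).orderTop := by
  obtain ⟨d, hd, hd1, hdξ⟩ := exists_pos_le_orderTop hξ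
  simpa using le_orderTop_subst (F := F) hd hd1 hdξ (N := 0) (by simp)

/-- Both sides are continuous and biadditive, so the identity follows from the case of polynomials
by applying `eq_zero_of_polynomial` in each argument in turn. -/
theorem subst_mul (F G : Ser2) {ξ : QSer} (hξ : 0 < ξ.orderTop) :
    subst (F * G) ξ = subst F ξ * subst G ξ := by
  obtain ⟨d, hd, hd1, hdξ⟩ := exists_pos_le_orderTop hξ
  have hbound : ∀ (F G : Ser2) (N : ℕ), (N : ℕ∞) ≤ F.order →
      ((N * d - 0 : ℚ) : WithTop ℚ) ≤ (subst (F * G) ξ - subst F ξ * subst G ξ).orderTop := by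
    intro F G N hN
    rw [sub_zero]
    refine le_orderTop_sub (le_orderTop_subst hd hd1 hdξ (le_order_mul_left hN)) ?_
    have := add_le_orderTop_mul (le_orderTop_subst hd hd1 hdξ hN)
      (b := 0) (orderTop_subst_nonneg G hξ)
    rwa [add_zero] at this
  rw [← sub_eq_zero]
  refine eq_zero_of_polynomial (T := fun F => subst (F * G) ξ - subst F ξ * subst G ξ)
    (fun A B => ?_) hd (fun A N => hbound A G N) (fun p => ?_) F
  · simp only [add_mul, subst_add]; ring
  refine eq_zero_of_polynomial (T := fun G => subst ((p : Ser2) * G) ξ - subst p ξ * subst G ξ)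
    (fun A B => ?_) hd (c := 0) (fun A N hN => ?_) (fun q => ?_) G
  · simp only [mul_add, subst_add]; ring
  · have := hbound A p N hN
    rwa [mul_comm A, mul_comm (subst A ξ)] at this
  · rw [← MvPolynomial.coe_mul, subst_coe _ hξ, subst_coe _ hξ, subst_coe _ hξ, map_mul, sub_self]

theorem subst_one {ξ : QSer} (hξ : 0 < ξ.orderTop) : subst 1 ξ = 1 := by
  rw [← MvPolynomial.coe_one, subst_coe _ hξ, map_one]

theorem subst_zero (ξ : QSer) : subst 0 ξ = 0 := by
  have := subst_add 0 0 ξ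
  simpa using this

/-- Substitution as a ring homomorphism. -/
def substHom (ξ : QSer) (hξ : 0 < ξ.orderTop) : Ser2 →+* QSer where
  toFun F := subst F ξ
  map_one' := subst_one hξ
  map_mul' F G := subst_mul F G hξ
  map_zero' := subst_zero ξ
  map_add' F G := subst_add F G ξ

theorem subst_sub (F G : Ser2) {ξ : QSer} (hξ : 0 < ξ.orderTop) :
    subst (F - G) ξ = subst F ξ - subst G ξ := map_sub (substHom ξ hξ) F G

theorem subst_pow (F : Ser2) {ξ : QSer} (hξ : 0 < ξ.orderTop) (n : ℕ) :
    subst (F ^ n) ξ = subst F ξ ^ n := map_pow (substHom ξ hξ) F n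

theorem subst_X_zero {ξ : QSer} (hξ : 0 < ξ.orderTop) :
    subst (MvPowerSeries.X 0) ξ = ξ := by
  rw [← MvPolynomial.coe_X, subst_coe _ hξ]; simp

theorem subst_X_one {ξ : QSer} (hξ : 0 < ξ.orderTop) :
    subst (MvPowerSeries.X 1) ξ = y := by
  rw [← MvPolynomial.coe_X, subst_coe _ hξ]; simp

theorem dx_add (F G : Ser2) : dx (F + G) = dx F + dx G := map_add _ _ _

theorem dy_add (F G : Ser2) : dy (F + G) = dy F + dy G := map_add _ _ _

theorem dx_mul (F G : Ser2) : dx (F * G) = F * dx G + G * dx F := by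
  simp [dx]

theorem dy_mul (F G : Ser2) : dy (F * G) = F * dy G + G * dy F := by
  simp [dy]

theorem le_order_pderiv (i : Fin 2) {F : Ser2} {N : ℕ} (hN : ((N + 1 : ℕ) : ℕ∞) ≤ F.order) :
    (N : ℕ∞) ≤ (MvPowerSeries.pderiv ℂ i F).order := by
  refine MvPowerSeries.le_order fun u hu => ?_
  rw [MvPowerSeries.coeff_pderiv, MvPowerSeries.coeff_of_lt_order, zero_mul]
  refine lt_of_lt_of_le ?_ hN
  have : u.degree < N := by exact_mod_cast hu
  simpa using this

/-- The chain rule along `x = ξ(y)`. -/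
theorem euler_subst (F : Ser2) {ξ : QSer} (hξ : 0 < ξ.orderTop) :
    euler (subst F ξ) = subst (dx F) ξ * euler ξ + y * subst (dy F) ξ := by
  obtain ⟨d, hd, hd1, hdξ⟩ := exists_pos_le_orderTop hξ
  rw [← sub_eq_zero]
  -- A partial derivative lowers the order of a series by at most one, which costs `d` in the
  -- estimate; hence `c = d`. For `N = 0` the required bound is negative and holds trivially.
  refine eq_zero_of_polynomial
    (T := fun F => euler (subst F ξ) - (subst (dx F) ξ * euler ξ + y * subst (dy F) ξ))
    (fun A B => ?_) hd (c := d) (fun A N hN => ?_) (fun p => ?_) F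
  · simp only [subst_add, dx_add, dy_add, map_add]; ring
  · refine le_orderTop_sub ?_ (le_orderTop_add ?_ ?_)
    · refine le_trans ?_ ((le_orderTop_subst hd hd1 hdξ hN).trans (orderTop_le_orderTop_euler _))
      exact_mod_cast sub_le_self _ hd.le
    · rcases N with _ | N
      · refine le_trans (b := ((0 + 0 : ℚ) : WithTop ℚ)) ?_ (add_le_orderTop_mul
          (orderTop_subst_nonneg _ hξ) (hξ.le.trans (orderTop_le_orderTop_euler ξ)))
        simpa using WithTop.coe_le_coe.2 (neg_lt_zero.2 hd).le
      · rw [Nat.cast_succ, add_one_mul, add_sub_cancel_right]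
        have := add_le_orderTop_mul (le_orderTop_subst hd hd1 hdξ (le_order_pderiv 0 hN))
          (b := 0) (hξ.le.trans (orderTop_le_orderTop_euler ξ))
        rwa [add_zero] at this
    · rcases N with _ | N
      · refine le_trans (b := ((0 + 0 : ℚ) : WithTop ℚ)) ?_ (add_le_orderTop_mul
          orderTop_y_pos.le (orderTop_subst_nonneg _ hξ))
        simpa using WithTop.coe_le_coe.2 (neg_lt_zero.2 hd).le
      · rw [Nat.cast_succ, add_one_mul, add_sub_cancel_right]
        have := add_le_orderTop_mul (a := 0) orderTop_y_pos.le
          (le_orderTop_subst hd hd1 hdξ (le_order_pderiv 1 hN))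
        rwa [zero_add] at this
  · rw [sub_eq_zero]
    induction p using MvPolynomial.induction_on with
    | C a =>
      rw [MvPolynomial.coe_C, dx, dy, MvPowerSeries.pderiv_C, MvPowerSeries.pderiv_C, subst_zero,
        ← MvPowerSeries.monomial_zero_eq_C_apply, subst_monomial _ _ hξ]
      simp [← HahnSeries.single_zero_one, euler_single]
    | add p q hp hq =>
      simp only [MvPolynomial.coe_add, subst_add, dx_add, dy_add, map_add, hp, hq]
      ring
    | mul_X p i hp =>
      rw [MvPolynomial.coe_mul, MvPolynomial.coe_X, subst_mul _ _ hξ, euler_mul, hp, dx_mul,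
        dy_mul, subst_add, subst_add, subst_mul _ _ hξ, subst_mul _ _ hξ, subst_mul _ _ hξ,
        subst_mul _ _ hξ]
      fin_cases i
      · simp [dx, dy, subst_X_zero hξ, subst_one hξ, subst_zero]
        ring
      · simp [dx, dy, subst_X_one hξ, subst_one hξ, subst_zero]
        rw [show euler y = y by simp [y, euler_single]]
        ring

/-- The Jacobian along an arc. -/
theorem y_mul_subst_jac (f g : Ser2) {ξ : QSer} (hξ : 0 < ξ.orderTop) :
    y * subst (jac f g) ξ =
      euler (subst f ξ) * subst (dx g) ξ - subst (dx f) ξ * euler (subst g ξ) := by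
  rw [euler_subst f hξ, euler_subst g hξ, jac, subst_sub _ _ hξ, subst_mul _ _ hξ,
    subst_mul _ _ hξ]
  ring

end Ser2

/-! ### Power series in `y ^ (1 / D)` as arcs, and polynomials with given roots. -/

namespace QSer

open Polynomial in
/-- The monic polynomial with the given roots. -/
def polyOfRoots (s : Multiset QSer) : Polynomial QSer := (s.map fun γ => X - C γ).prod

/-- The exponent map `n ↦ n / D`. -/
def divHom (D : ℕ) : ℕ →+ ℚ :=
  (AddMonoidHom.mulRight ((D : ℚ)⁻¹)).comp (Nat.castAddMonoidHom ℚ)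

theorem divHom_apply (D n : ℕ) : divHom D n = (n : ℚ) / D := by
  simp [divHom, div_eq_mul_inv]

theorem divHom_le_iff {D : ℕ} (hD : D ≠ 0) (m n : ℕ) : divHom D m ≤ divHom D n ↔ m ≤ n := by
  have hD' : (0 : ℚ) < D := by exact_mod_cast Nat.pos_of_ne_zero hD
  rw [divHom_apply, divHom_apply, div_le_div_iff_of_pos_right hD']
  exact Nat.cast_le

theorem divHom_injective {D : ℕ} (hD : D ≠ 0) : Function.Injective (divHom D) := fun m n h =>
  le_antisymm ((divHom_le_iff hD m n).1 h.le) ((divHom_le_iff hD n m).1 h.ge)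

/-- The embedding `ℂ⟦X⟧ → QSer`, `X ↦ y ^ (1 / D)`. -/
def ofPow (D : ℕ) (hD : D ≠ 0) : PowerSeries ℂ →+* QSer :=
  (HahnSeries.embDomainRingHom (divHom D) (divHom_injective hD) (divHom_le_iff hD)).comp
    (HahnSeries.toPowerSeries (R := ℂ)).symm.toRingHom

theorem coeff_ofPow (D : ℕ) (hD : D ≠ 0) (a : PowerSeries ℂ) (n : ℕ) :
    (ofPow D hD a).coeff ((n : ℚ) / D) = PowerSeries.coeff n a := by
  rw [← divHom_apply, ← HahnSeries.coeff_toPowerSeries_symm]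
  exact HahnSeries.embDomain_coeff
    (f := ⟨⟨divHom D, divHom_injective hD⟩, divHom_le_iff hD _ _⟩)

theorem coeff_ofPow_of_forall_ne (D : ℕ) (hD : D ≠ 0) (a : PowerSeries ℂ) {e : ℚ}
    (he : ∀ n : ℕ, (n : ℚ) / D ≠ e) : (ofPow D hD a).coeff e = 0 := by
  refine HahnSeries.embDomain_of_notMem_range
    (f := ⟨⟨divHom D, divHom_injective hD⟩, divHom_le_iff hD _ _⟩) ?_
  rintro ⟨n, hn⟩
  exact he n (by rw [← divHom_apply]; exact hn)

/-- The base change `X ↦ X ^ D` followed by `X ↦ y ^ (1 / D)` is `X ↦ y`. This turns a splitting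
after base change into a splitting over fractional series. -/
theorem ofPow_expand (D : ℕ) (hD : D ≠ 0) (a : PowerSeries ℂ) :
    ofPow D hD (PowerSeries.expand D hD a) = ofPow 1 one_ne_zero a := by
  have hD' : (D : ℚ) ≠ 0 := by exact_mod_cast hD
  ext e
  by_cases h1 : ∃ n : ℕ, (n : ℚ) / D = e
  · obtain ⟨n, rfl⟩ := h1
    rw [coeff_ofPow, PowerSeries.coeff_expand]
    split_ifs with h
    · obtain ⟨k, rfl⟩ := h
      rw [Nat.mul_div_cancel_left _ (Nat.pos_of_ne_zero hD), ← coeff_ofPow 1 one_ne_zero]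
      congr 1
      push_cast
      field_simp
    · rw [coeff_ofPow_of_forall_ne]
      intro k hk
      apply h
      refine ⟨k, ?_⟩
      rw [Nat.cast_one, div_one, eq_div_iff hD'] at hk
      rw [mul_comm]
      exact_mod_cast hk.symm
  · push Not at h1
    rw [coeff_ofPow_of_forall_ne D hD _ h1, coeff_ofPow_of_forall_ne]
    intro k hk
    apply h1 (k * D)
    rw [← hk]
    push_cast
    field_simp

theorem isArc_ofPow (D : ℕ) (hD : D ≠ 0) {a : PowerSeries ℂ}
    (ha : PowerSeries.constantCoeff a = 0) : (ofPow D hD a).IsArc := by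
  have hD' : (0 : ℚ) < D := by exact_mod_cast Nat.pos_of_ne_zero hD
  have hsupp : ∀ e ∈ (ofPow D hD a).support, ∃ n : ℕ, n ≠ 0 ∧ (n : ℚ) / D = e := by
    intro e he
    by_contra! h
    apply he
    by_cases h1 : ∃ n : ℕ, (n : ℚ) / D = e
    · obtain ⟨n, rfl⟩ := h1
      by_cases hn : n = 0
      · rw [coeff_ofPow, hn, PowerSeries.coeff_zero_eq_constantCoeff_apply, ha]
      · exact absurd rfl (h n hn)
    · push Not at h1
      exact coeff_ofPow_of_forall_ne D hD a h1
  refine ⟨?_, D, Nat.pos_of_ne_zero hD, fun e he => ?_⟩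
  · by_cases h0 : ofPow D hD a = 0
    · simp [h0]
    · rw [HahnSeries.orderTop_of_ne_zero h0]
      obtain ⟨n, hn, he⟩ := hsupp _ (Set.IsWF.min_mem _ (HahnSeries.support_nonempty_iff.2 h0))
      rw [← he]
      have : 0 < (n : ℚ) / D := div_pos (by exact_mod_cast Nat.pos_of_ne_zero hn) hD'
      exact_mod_cast this
  · obtain ⟨n, _, rfl⟩ := hsupp e he
    exact ⟨n, by field_simp⟩

instance charZero : CharZero QSer :=
  charZero_of_injective_ringHom (HahnSeries.C_injective (Γ := ℚ) (R := ℂ))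

theorem polyOfRoots_ne_zero (s : Multiset QSer) : polyOfRoots s ≠ 0 :=
  (Polynomial.monic_multisetProd_X_sub_C s).ne_zero

theorem eval_polyOfRoots (s : Multiset QSer) (ξ : QSer) :
    (polyOfRoots s).eval ξ = (s.map fun γ => ξ - γ).prod := by
  rw [polyOfRoots, Polynomial.eval_multiset_prod, Multiset.map_map]
  simp

open scoped Classical in
theorem rootMultiplicity_polyOfRoots (s : Multiset QSer) (ξ : QSer) :
    (polyOfRoots s).rootMultiplicity ξ = s.count ξ := by
  rw [← Polynomial.count_roots, polyOfRoots, Polynomial.roots_multiset_prod_X_sub_C]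

end QSer

/-! ### Newton-Puiseux factorization in `ℂ⟦x, y⟧` and counting of roots. -/

namespace Ser2

open QSer

/-- The identification of the index of the variables `x`, `y` with `none`, `some ()`. -/
def indexEquiv : Fin 2 ≃ Option Unit :=
  (finSuccEquiv 1).trans (Equiv.optionCongr (Equiv.ofUnique (Fin 1) Unit))

/-- `ℂ⟦x, y⟧` as the ring of power series in `x` over `ℂ⟦y⟧`. -/
def toIter : Ser2 ≃ₐ[ℂ] PowerSeries (PowerSeries ℂ) :=
  (MvPowerSeries.renameEquiv ℂ indexEquiv).trans (MvPowerSeries.optionEquivLeft Unit ℂ)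

theorem coeff_toIter (F : Ser2) (i j : ℕ) :
    PowerSeries.coeff j (PowerSeries.coeff i (toIter F)) = coeffXY i j F := by
  have h : Finsupp.optionElim i (Finsupp.single () j) =
      Finsupp.embDomain indexEquiv.toEmbedding (Finsupp.single 0 i + Finsupp.single 1 j) := by
    rw [Finsupp.embDomain_add, Finsupp.embDomain_single, Finsupp.embDomain_single]
    ext a
    rcases a with _ | a
    · simp [indexEquiv]
    · simp [indexEquiv, Finsupp.single_apply]
  rw [PowerSeries.coeff]
  change MvPowerSeries.coeff (Finsupp.single () j) (PowerSeries.coeff i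
    (MvPowerSeries.optionEquivLeft Unit ℂ (MvPowerSeries.rename indexEquiv F))) = _
  rw [MvPowerSeries.coeff_coeff_optionEquivLeft, h]
  exact MvPowerSeries.coeff_embDomain_rename _ _ _

theorem coeffXY_toIter_symm (G : PowerSeries (PowerSeries ℂ)) (i j : ℕ) :
    coeffXY i j (toIter.symm G) = PowerSeries.coeff j (PowerSeries.coeff i G) := by
  rw [← coeff_toIter, AlgEquiv.apply_symm_apply]

theorem ext_coeffXY {F G : Ser2} (h : ∀ i j, coeffXY i j F = coeffXY i j G) : F = G := by
  ext u
  rw [coeffXY_eq, coeffXY_eq, h]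

theorem coeffXY_dx (F : Ser2) (i j : ℕ) :
    coeffXY i j (dx F) = coeffXY (i + 1) j F * ((i : ℂ) + 1) := by
  rw [coeffXY, dx, MvPowerSeries.coeff_pderiv, coeffXY_eq]
  simp

theorem dx_toIter_symm (P : Polynomial (PowerSeries ℂ)) :
    dx (toIter.symm (P : PowerSeries (PowerSeries ℂ))) =
      toIter.symm ((Polynomial.derivative P : Polynomial (PowerSeries ℂ)) :
        PowerSeries (PowerSeries ℂ)) := by
  apply ext_coeffXY
  intro i j
  rw [coeffXY_dx, coeffXY_toIter_symm, coeffXY_toIter_symm, Polynomial.coeff_coe,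
    Polynomial.coeff_coe, Polynomial.coeff_derivative]
  have : ((i : PowerSeries ℂ) + 1) = PowerSeries.C ((i : ℂ) + 1) := by simp
  rw [this, PowerSeries.coeff_mul_C]

theorem iterate_dx_toIter_symm (k : ℕ) (P : Polynomial (PowerSeries ℂ)) :
    dx^[k] (toIter.symm (P : PowerSeries (PowerSeries ℂ))) =
      toIter.symm ((Polynomial.derivative^[k] P : Polynomial (PowerSeries ℂ)) :
        PowerSeries (PowerSeries ℂ)) := by
  induction k generalizing P with
  | zero => rfl
  | succ k ih => rw [Function.iterate_succ_apply, dx_toIter_symm, ih, Function.iterate_succ_apply]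

theorem subst_toIter_symm_C (a : PowerSeries ℂ) {ξ : QSer} (hξ : 0 < ξ.orderTop) :
    subst (toIter.symm (PowerSeries.C a)) ξ = ofPow 1 one_ne_zero a := by
  have hy : ∀ n : ℕ, y ^ n = HahnSeries.single (n : ℚ) (1 : ℂ) := by
    intro n
    rw [y, HahnSeries.single_pow, one_pow, nsmul_one]
  have hterm : ∀ (n : ℕ × ℕ) (e : ℚ), coeffXY n.1 n.2 (toIter.symm (PowerSeries.C a)) *
      (ξ ^ n.1 * y ^ n.2).coeff e =
      if n.1 = 0 ∧ (n.2 : ℚ) = e then PowerSeries.coeff n.2 a else 0 := by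
    rintro ⟨i, j⟩ e
    rw [coeffXY_toIter_symm, PowerSeries.coeff_C]
    by_cases hi : i = 0
    · subst hi
      by_cases hj : (j : ℚ) = e
      · subst hj; simp [hy]
      · simp [hj, hy, HahnSeries.coeff_single_of_ne (Ne.symm hj)]
    · simp [hi]
  ext e
  rw [coeff_subst _ hξ, finsum_congr fun n => hterm n e]
  by_cases h : ∃ n : ℕ, (n : ℚ) / (1 : ℕ) = e
  · obtain ⟨n, rfl⟩ := h
    rw [coeff_ofPow, finsum_eq_single _ (0, n)]
    · simp
    · rintro ⟨i, j⟩ hij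
      rw [if_neg]
      rintro ⟨rfl, hj⟩
      apply hij
      rw [Nat.cast_one, div_one] at hj
      exact Prod.ext rfl (by exact_mod_cast hj)
  · push Not at h
    rw [coeff_ofPow_of_forall_ne _ _ _ h]
    apply finsum_eq_zero_of_forall_eq_zero
    intro n
    rw [if_neg]
    rintro ⟨-, hn⟩
    exact h n.2 (by simpa using hn)

/-- Two ring homomorphisms on `ℂ⟦y⟧[x]` that agree on the coefficients and on `x`. -/
theorem subst_toIter_symm_coe (P : Polynomial (PowerSeries ℂ)) {ξ : QSer} (hξ : 0 < ξ.orderTop) :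
    subst (toIter.symm (P : PowerSeries (PowerSeries ℂ))) ξ =
      (P.map (ofPow 1 one_ne_zero)).eval ξ := by
  have hX : toIter.symm PowerSeries.X = MvPowerSeries.X 0 := by
    rw [AlgEquiv.symm_apply_eq]
    simp [toIter, indexEquiv, MvPowerSeries.optionEquivLeft_X_none]
  have h : (substHom ξ hξ).comp ((toIter.symm : PowerSeries (PowerSeries ℂ) →+* Ser2).comp
      Polynomial.coeToPowerSeries.ringHom) = Polynomial.eval₂RingHom (ofPow 1 one_ne_zero) ξ := by
    apply Polynomial.ringHom_ext
    · intro a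
      simpa [substHom] using subst_toIter_symm_C a hξ
    · simpa [substHom, hX] using subst_X_zero hξ
  rw [Polynomial.eval_map]
  exact congrArg (fun φ => φ P) h

theorem coeff_zero_subst (F : Ser2) {ξ : QSer} (hξ : 0 < ξ.orderTop) :
    (subst F ξ).coeff 0 = MvPowerSeries.constantCoeff F := by
  obtain ⟨d, hd, hd1, hdξ⟩ := exists_pos_le_orderTop hξ
  set c := MvPowerSeries.constantCoeff F
  have hF : F = MvPowerSeries.monomial 0 c + (F - MvPowerSeries.C c) := by
    rw [MvPowerSeries.monomial_zero_eq_C_apply]; ring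
  have h1 : ((1 : ℕ) : ℕ∞) ≤ (F - MvPowerSeries.C c).order := by
    rw [Nat.cast_one, MvPowerSeries.one_le_order_iff_constCoeff_eq_zero]
    simp [c]
  rw [hF, subst_add, subst_monomial _ _ hξ, HahnSeries.coeff_add,
    coe_le_orderTop_iff.1 (le_orderTop_subst hd hd1 hdξ h1) 0 (by simpa using hd)]
  simp

theorem subst_ne_zero_of_constantCoeff {U : Ser2} (hU : MvPowerSeries.constantCoeff U ≠ 0)
    {ξ : QSer} (hξ : 0 < ξ.orderTop) : subst U ξ ≠ 0 := by
  intro h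
  rw [← coeff_zero_subst U hξ, h] at hU
  exact hU rfl

/-- `F = y ^ E * U * P` with `U` a unit and `P` the monic polynomial in `x` whose roots are the
arcs in `s`. -/
structure IsFactorization (F U P : Ser2) (s : Multiset QSer) : Prop where
  eq_mul : F = MvPowerSeries.X 1 ^ yExp F * U * P
  unit : MvPowerSeries.constantCoeff U ≠ 0
  isArc : ∀ γ ∈ s, γ.IsArc
  -- All `x`-derivatives are recorded because `rootMult` is defined through them.
  subst_iterate : ∀ (k : ℕ) (ξ : QSer), 0 < ξ.orderTop →
    subst (dx^[k] P) ξ = (Polynomial.derivative^[k] (polyOfRoots s)).eval ξ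

theorem exists_not_dvd {F : Ser2} (hF : F ≠ 0) :
    ∃ G : Ser2, F = MvPowerSeries.X 1 ^ yExp F * G ∧ ¬ (MvPowerSeries.X 1 : Ser2) ∣ G := by
  have hfin : FiniteMultiplicity (MvPowerSeries.X 1 : Ser2) F := by
    obtain ⟨u, hu⟩ := (MvPowerSeries.ne_zero_iff_exists_coeff_ne_zero F).1 hF
    refine ⟨u 1, fun h => hu ?_⟩
    exact MvPowerSeries.X_pow_dvd_iff.1 h u (Nat.lt_succ_self _)
  exact hfin.exists_eq_pow_mul_and_not_dvd

/-- The **Newton-Puiseux factorization** of a power series in two variables. -/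
theorem exists_isFactorization {F : Ser2} (hF : F ≠ 0) :
    ∃ U P s, IsFactorization F U P s := by
  obtain ⟨G, hFG, hG⟩ := exists_not_dvd hF
  -- Since `y` does not divide `G`, the series `G(x, 0)` is nonzero, which is what Weierstrass
  -- preparation in `x` requires.
  have hmap : PowerSeries.map (PowerSeries.constantCoeff (R := ℂ)) (toIter G) ≠ 0 := by
    intro h
    apply hG
    rw [MvPowerSeries.X_dvd_iff]
    intro u hu
    rw [coeffXY_eq, hu, ← coeff_toIter, PowerSeries.coeff_zero_eq_constantCoeff_apply,
      ← PowerSeries.coeff_map, h, map_zero]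
  obtain ⟨P, U, hP, hU, hfac, -⟩ := NewtonPuiseux.exists_weierstrass hmap
  obtain ⟨D, hD, s, hs, hprod⟩ := NewtonPuiseux.exists_splitting _ P hP rfl
  refine ⟨toIter.symm U, toIter.symm P, s.map (ofPow D hD), ?_, ?_, ?_, ?_⟩
  · have hG' : G = toIter.symm P * toIter.symm U := by
      rw [← map_mul, ← hfac, AlgEquiv.symm_apply_apply]
    rw [mul_assoc, mul_comm (toIter.symm U), ← hG', ← hFG]
  · exact ((hU.map toIter.symm).map MvPowerSeries.constantCoeff).ne_zero
  · intro γ hγ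
    obtain ⟨η, hη, rfl⟩ := Multiset.mem_map.1 hγ
    exact isArc_ofPow D hD (hs η hη)
  · intro k ξ hξ
    have hPs : P.map (ofPow 1 one_ne_zero) = polyOfRoots (s.map (ofPow D hD)) := by
      have h1 : ofPow 1 one_ne_zero = (ofPow D hD).comp
          (PowerSeries.expand D hD : PowerSeries ℂ →ₐ[ℂ] PowerSeries ℂ).toRingHom := by
        ext1 a
        exact (ofPow_expand D hD a).symm
      rw [h1, ← Polynomial.map_map, hprod, Polynomial.map_multiset_prod, polyOfRoots,
        Multiset.map_map, Multiset.map_map]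
      simp
    rw [iterate_dx_toIter_symm, subst_toIter_symm_coe _ hξ, ← Polynomial.iterate_derivative_map,
      hPs]

theorem iterate_dx_add (k : ℕ) (F G : Ser2) : dx^[k] (F + G) = dx^[k] F + dx^[k] G :=
  iterate_map_add (MvPowerSeries.pderiv ℂ (0 : Fin 2)) k F G

/-- In the Leibniz expansion only the term with all `k` derivatives on `P` survives. -/
theorem subst_iterate_dx_mul {ξ : QSer} (hξ : 0 < ξ.orderTop) (k : ℕ) : ∀ V P : Ser2,
    (∀ j < k, subst (dx^[j] P) ξ = 0) →
      subst (dx^[k] (V * P)) ξ = subst V ξ * subst (dx^[k] P) ξ := by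
  induction k with
  | zero => intro V P _; exact subst_mul V P hξ
  | succ k ih =>
    intro V P h
    rw [Function.iterate_succ_apply, dx_mul, iterate_dx_add, subst_add, mul_comm P,
      ih V (dx P) (fun j hj => by
        rw [← Function.iterate_succ_apply]; exact h (j + 1) (by omega)),
      ih (dx V) P (fun j hj => h j (by omega)), h k (by omega), mul_zero, add_zero,
      Function.iterate_succ_apply]

namespace IsFactorization

variable {F U P : Ser2} {s : Multiset QSer}

theorem subst_unit_ne_zero (h : IsFactorization F U P s) {ξ : QSer} (hξ : 0 < ξ.orderTop) :
    subst (MvPowerSeries.X 1 ^ yExp F * U) ξ ≠ 0 := by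
  rw [subst_mul _ _ hξ, subst_pow _ hξ, subst_X_one hξ]
  exact mul_ne_zero (pow_ne_zero _ y_ne_zero) (subst_ne_zero_of_constantCoeff h.unit hξ)

theorem subst_eq (h : IsFactorization F U P s) {ξ : QSer} (hξ : 0 < ξ.orderTop) :
    subst F ξ = y ^ yExp F * subst U ξ * (polyOfRoots s).eval ξ := by
  have h0 := h.subst_iterate 0 ξ hξ
  simp only [Function.iterate_zero, id_eq] at h0
  conv_lhs => rw [h.eq_mul]
  rw [subst_mul _ _ hξ, subst_mul _ _ hξ, subst_pow _ hξ, subst_X_one hξ, h0]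

theorem subst_dx_eq (h : IsFactorization F U P s) {ξ : QSer} (hξ : 0 < ξ.orderTop) :
    subst (dx F) ξ = y ^ yExp F * (subst U ξ * (Polynomial.derivative (polyOfRoots s)).eval ξ +
      subst (dx U) ξ * (polyOfRoots s).eval ξ) := by
  have h0 := h.subst_iterate 0 ξ hξ
  have h1 := h.subst_iterate 1 ξ hξ
  simp only [Function.iterate_zero, id_eq, Function.iterate_one] at h0 h1
  have h2 : dx (MvPowerSeries.X 1 ^ yExp F : Ser2) = 0 := by
    rw [dx, MvPowerSeries.pderiv_pow, MvPowerSeries.pderiv_X_of_ne (by decide), mul_zero]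
  conv_lhs => rw [h.eq_mul]
  rw [mul_assoc, dx_mul, h2, mul_zero, add_zero, dx_mul, subst_mul _ _ hξ, subst_pow _ hξ,
    subst_X_one hξ, subst_add, subst_mul _ _ hξ, subst_mul _ _ hξ, h0, h1]
  ring

theorem mem_roots_iff (h : IsFactorization F U P s) (ξ : QSer) : ξ ∈ roots F ↔ ξ ∈ s := by
  constructor
  · rintro ⟨harc, h0⟩
    rw [h.subst_eq harc.1, ← subst_X_one harc.1, ← subst_pow _ harc.1, ← subst_mul _ _ harc.1,
      mul_eq_zero, or_iff_right (h.subst_unit_ne_zero harc.1), eval_polyOfRoots,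
      Multiset.prod_eq_zero_iff, Multiset.mem_map] at h0
    obtain ⟨γ, hγ, h0⟩ := h0
    rwa [sub_eq_zero.1 h0]
  · intro hξ
    have harc := h.isArc ξ hξ
    refine ⟨harc, ?_⟩
    rw [h.subst_eq harc.1, eval_polyOfRoots, Multiset.prod_eq_zero, mul_zero]
    exact Multiset.mem_map.2 ⟨ξ, hξ, sub_self ξ⟩

open scoped Classical in
-- In characteristic zero the multiplicity of a root is the first order at which a derivative does
-- not vanish; the factor `y ^ E * U` does not affect this order, being nonzero along `ξ`.
theorem rootMult_eq (h : IsFactorization F U P s) {ξ : QSer} (hξ : 0 < ξ.orderTop) :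
    rootMult F ξ = s.count ξ := by
  rw [← rootMultiplicity_polyOfRoots]
  set m := (polyOfRoots s).rootMultiplicity ξ with hm
  have hlt := fun n => Polynomial.lt_rootMultiplicity_iff_isRoot_iterate_derivative
    (t := ξ) (n := n) (polyOfRoots_ne_zero s)
  have hzero : ∀ j < m, subst (dx^[j] P) ξ = 0 := fun j hj => by
    rw [h.subst_iterate j ξ hξ]
    exact (hlt j).1 hj j le_rfl
  have hne : subst (dx^[m] P) ξ ≠ 0 := by
    intro h0
    refine lt_irrefl m ((hlt m).2 fun k hk => ?_)
    rw [Polynomial.IsRoot, ← h.subst_iterate k ξ hξ]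
    rcases hk.lt_or_eq with hk | rfl
    · exact hzero k hk
    · exact h0
  have hF : ∀ k ≤ m, subst (dx^[k] F) ξ =
      subst (MvPowerSeries.X 1 ^ yExp F * U) ξ * subst (dx^[k] P) ξ := by
    intro k hk
    conv_lhs => rw [h.eq_mul]
    exact subst_iterate_dx_mul hξ k _ _ fun j hj => hzero j (hj.trans_le hk)
  refine IsLeast.csInf_eq ⟨?_, fun k hk => ?_⟩
  · change subst (dx^[m] F) ξ ≠ 0
    rw [hF m le_rfl]
    exact mul_ne_zero (h.subst_unit_ne_zero hξ) hne
  · by_contra hkm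
    apply hk
    rw [hF k (not_le.1 hkm).le, hzero k (not_le.1 hkm), mul_zero]

open scoped Classical in
theorem rootCount_eq (h : IsFactorization F U P s) (S : Set QSer) :
    rootCount F S = (s.filter (· ∈ S)).card := by
  have hset : roots F ∩ S = ((s.filter (· ∈ S)).toFinset : Set QSer) := by
    ext ξ
    simp [h.mem_roots_iff]
  rw [rootCount, hset, finsum_mem_coe_finset, ← Multiset.toFinset_sum_count_eq]
  refine Finset.sum_congr rfl fun ξ hξ => ?_
  rw [Multiset.mem_toFinset, Multiset.mem_filter] at hξ
  rw [h.rootMult_eq (h.isArc ξ hξ.1).1, Multiset.count_filter, if_pos hξ.2]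

end IsFactorization

theorem finite_roots {F : Ser2} (hF : F ≠ 0) : (roots F).Finite := by
  classical
  obtain ⟨U, P, s, h⟩ := exists_isFactorization hF
  refine (s.toFinset.finite_toSet).subset fun ξ hξ => ?_
  simpa using (h.mem_roots_iff ξ).1 hξ

end Ser2

open Ser2

/-! ### Initial terms of families of series with a parameter. -/

namespace QSer

open Polynomial

/-- The family `A z = W(z) y ^ ν + ⋯`, where `W` is a polynomial in the parameter `z`. -/
def IsLead (A : ℂ → QSer) (ν : ℚ) (W : ℂ[X]) : Prop :=
  ∀ z, (ν : WithTop ℚ) ≤ (A z).orderTop ∧ (A z).coeff ν = W.eval z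

theorem coeff_mul_add {x z : QSer} {a b : ℚ} (hx : (a : WithTop ℚ) ≤ x.orderTop)
    (hz : (b : WithTop ℚ) ≤ z.orderTop) : (x * z).coeff (a + b) = x.coeff a * z.coeff b := by
  rw [coe_le_orderTop_iff] at hx hz
  rw [HahnSeries.coeff_mul, Finset.sum_eq_single (a, b)]
  · rintro ⟨i, j⟩ hij hne
    rw [Finset.mem_antidiagonal] at hij
    obtain ⟨-, -, hij⟩ := hij
    by_cases hi : i < a
    · simp [hx i hi]
    · by_cases hj : j < b
      · simp [hz j hj]
      · simp only at hij
        refine absurd (Prod.ext ?_ ?_) hne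
        · simp only; linarith
        · simp only; linarith
  · intro h
    by_contra h0
    apply h
    rw [Finset.mem_antidiagonal]
    exact ⟨left_ne_zero_of_mul h0, right_ne_zero_of_mul h0, rfl⟩

namespace IsLead

variable {A A' : ℂ → QSer} {ν ν' : ℚ} {W W' : ℂ[X]}

theorem mul (h : IsLead A ν W) (h' : IsLead A' ν' W') :
    IsLead (fun z => A z * A' z) (ν + ν') (W * W') := fun z =>
  ⟨add_le_orderTop_mul (h z).1 (h' z).1, by
    rw [coeff_mul_add (h z).1 (h' z).1, (h z).2, (h' z).2, eval_mul]⟩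

theorem add (h : IsLead A ν W) (h' : IsLead A' ν W') :
    IsLead (fun z => A z + A' z) ν (W + W') := fun z =>
  ⟨le_orderTop_add (h z).1 (h' z).1, by
    rw [HahnSeries.coeff_add, (h z).2, (h' z).2, eval_add]⟩

theorem sub (h : IsLead A ν W) (h' : IsLead A' ν W') :
    IsLead (fun z => A z - A' z) ν (W - W') := fun z =>
  ⟨le_orderTop_sub (h z).1 (h' z).1, by
    rw [HahnSeries.coeff_sub, (h z).2, (h' z).2, eval_sub]⟩

theorem euler (h : IsLead A ν W) : IsLead (fun z => QSer.euler (A z)) ν (C (ν : ℂ) * W) :=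
  fun z => ⟨(h z).1.trans (orderTop_le_orderTop_euler _), by
    rw [coeff_euler, (h z).2, eval_mul, eval_C]⟩

theorem of_lt (h : IsLead A ν W) (hν : ν' < ν) : IsLead A ν' 0 := fun z =>
  ⟨le_trans (by exact_mod_cast hν.le) (h z).1, by
    rw [coe_le_orderTop_iff.1 (h z).1 ν' hν, eval_zero]⟩

theorem eq_zero_of_lt (h : IsLead A ν W) (h' : IsLead A ν' W') (hν : ν < ν') : W = 0 := by
  apply Polynomial.funext
  intro z
  rw [← (h z).2, coe_le_orderTop_iff.1 (h' z).1 ν hν, eval_zero]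

/-- This identifies the initial polynomial of `y J` obtained from the chain rule with the one
obtained from the factorization of `J`. -/
theorem unique (h : IsLead A ν W) (h' : IsLead A ν' W') (hW : W ≠ 0) (hW' : W' ≠ 0) :
    ν = ν' ∧ W = W' := by
  have hν : ν = ν' := by
    rcases lt_trichotomy ν ν' with hlt | heq | hlt
    · exact absurd (h.eq_zero_of_lt h' hlt) hW
    · exact heq
    · exact absurd (h'.eq_zero_of_lt h hlt) hW'
  subst hν
  exact ⟨rfl, Polynomial.funext fun z => by rw [← (h z).2, (h' z).2]⟩

theorem orderTop_eq (h : IsLead A ν W) {z : ℂ} (hz : W.eval z ≠ 0) :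
    (A z).orderTop = (ν : WithTop ℚ) := by
  refine le_antisymm (HahnSeries.orderTop_le_of_coeff_ne_zero ?_) (h z).1
  rwa [(h z).2]

end IsLead

theorem isLead_single (a : ℚ) : IsLead (fun _ => HahnSeries.single a 1) a 1 := fun z =>
  ⟨HahnSeries.orderTop_single_le, by simp⟩

theorem isLead_y_pow (n : ℕ) : IsLead (fun _ => y ^ n) (n : ℚ) 1 := by
  have : y ^ n = HahnSeries.single (n : ℚ) 1 := by
    rw [y, HahnSeries.single_pow, one_pow, nsmul_one]
  rw [this]
  exact isLead_single _

end QSer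

/-! ### Degree of a weighted Wronskian. -/

namespace Polynomial

theorem coeff_X_mul_derivative (A : ℂ[X]) (n : ℕ) :
    (X * derivative A).coeff n = n * A.coeff n := by
  rcases n with _ | n
  · simp
  · rw [coeff_X_mul, coeff_derivative, mul_comm]; push_cast; rfl

/-- Multiplication by `X` replaces `d/dX` by `X d/dX`, which scales the coefficient of degree `n` by
`n`. The top coefficient is then `(a deg B - b deg A)` times the leading coefficients, and constant
`A` or `B` needs no separate case. -/
theorem natDegree_weighted_wronskian {A B : ℂ[X]} {a b : ℂ} (hA : A ≠ 0) (hB : B ≠ 0)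
    (h : a * B.natDegree - b * A.natDegree ≠ 0) :
    C a * A * derivative B - derivative A * (C b * B) ≠ 0 ∧
    (C a * A * derivative B - derivative A * (C b * B)).natDegree + 1 =
      A.natDegree + B.natDegree := by
  set W := C a * A * derivative B - derivative A * (C b * B) with hW
  have hle : ∀ D : ℂ[X], (X * derivative D).natDegree ≤ D.natDegree := by
    intro D
    rw [natDegree_le_iff_coeff_eq_zero]
    intro n hn
    rw [coeff_X_mul_derivative, coeff_eq_zero_of_natDegree_lt hn, mul_zero]
  have hXW : X * W = C a * (A * (X * derivative B)) - C b * ((X * derivative A) * B) := by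
    rw [hW]; ring
  have hcoeff : (X * W).coeff (A.natDegree + B.natDegree) ≠ 0 := by
    rw [hXW, coeff_sub, coeff_C_mul, coeff_C_mul, coeff_mul_add_eq_of_natDegree_le le_rfl (hle B),
      coeff_mul_add_eq_of_natDegree_le (hle A) le_rfl, coeff_X_mul_derivative, coeff_X_mul_derivative]
    have : a * (A.coeff A.natDegree * (B.natDegree * B.coeff B.natDegree)) -
        b * (A.natDegree * A.coeff A.natDegree * B.coeff B.natDegree) =
        (a * B.natDegree - b * A.natDegree) * (A.leadingCoeff * B.leadingCoeff) := by
      rw [leadingCoeff, leadingCoeff]; ring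
    rw [this]
    exact mul_ne_zero h (mul_ne_zero (leadingCoeff_ne_zero.2 hA) (leadingCoeff_ne_zero.2 hB))
  have hdeg : (X * W).natDegree ≤ A.natDegree + B.natDegree := by
    rw [hXW]
    refine (natDegree_sub_le _ _).trans (max_le ?_ ?_)
    · exact (natDegree_C_mul_le _ _).trans
        (natDegree_mul_le.trans (Nat.add_le_add_left (hle B) _))
    · exact (natDegree_C_mul_le _ _).trans
        (natDegree_mul_le.trans (Nat.add_le_add_right (hle A) _))
  have hW0 : W ≠ 0 := by
    intro h0
    rw [h0, mul_zero, coeff_zero] at hcoeff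
    exact hcoeff rfl
  refine ⟨hW0, ?_⟩
  rw [← natDegree_X_mul hW0]
  exact natDegree_eq_of_le_of_coeff_ne_zero hdeg hcoeff

end Polynomial

/-! ### Initial terms along a bar and roots of the Jacobian over it. -/

namespace Bar

open QSer Polynomial

variable (B : Bar)

/-- `ξ` climbs over `B` at some point. -/
def Over (ξ : QSer) : Prop := (B.height : WithTop ℚ) ≤ (ξ - B.stem).orderTop

/-- The coefficient at `y ^ h(B)` of `ξ - λ_B`. -/
def slope (ξ : QSer) : ℂ := (ξ - B.stem).coeff B.height

theorem climbsAt_iff (ξ : QSer) (c : ℂ) : B.ClimbsAt ξ c ↔ B.Over ξ ∧ B.slope ξ = c := by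
  have h : ξ - B.arc c = ξ - B.stem - HahnSeries.single B.height c := by rw [arc]; ring
  rw [ClimbsAt, Over, slope, h]
  constructor
  · intro hlt
    refine ⟨?_, ?_⟩
    · have h1 : ξ - B.stem =
          (ξ - B.stem - HahnSeries.single B.height c) + HahnSeries.single B.height c := by ring
      rw [h1]
      exact le_orderTop_add hlt.le HahnSeries.orderTop_single_le
    · have := HahnSeries.coeff_eq_zero_of_lt_orderTop hlt
      rw [HahnSeries.coeff_sub, HahnSeries.coeff_single_same] at this
      exact sub_eq_zero.1 this
  · rintro ⟨hle, rfl⟩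
    refine lt_of_le_of_ne (le_orderTop_sub hle HahnSeries.orderTop_single_le) fun heq => ?_
    refine HahnSeries.coeff_orderTop_ne heq.symm ?_
    rw [HahnSeries.coeff_sub, HahnSeries.coeff_single_same, sub_self]

theorem exists_climbsAt_iff (ξ : QSer) : (∃ c, B.ClimbsAt ξ c) ↔ B.Over ξ := by
  simp [climbsAt_iff]

theorem arc_sub (z : ℂ) (γ : QSer) :
    B.arc z - γ = HahnSeries.single B.height z - (γ - B.stem) := by
  rw [arc]; ring

open scoped Classical in
/-- The order of `λ_B + z y ^ h(B) - γ` for generic `z`. -/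
def contact (γ : QSer) : ℚ := if B.Over γ then B.height else (γ - B.stem).order

open scoped Classical in
/-- The initial coefficient of `λ_B + z y ^ h(B) - γ`, as a polynomial in `z`. -/
def lin (γ : QSer) : ℂ[X] :=
  if B.Over γ then X - C (B.slope γ) else C (-(γ - B.stem).leadingCoeff)

theorem ne_zero_of_not_over {γ : QSer} (h : ¬ B.Over γ) : γ - B.stem ≠ 0 := by
  intro h0
  apply h
  rw [Over, h0, HahnSeries.orderTop_zero]
  exact le_top

theorem order_lt_of_not_over {γ : QSer} (h : ¬ B.Over γ) : (γ - B.stem).order < B.height := by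
  have h1 := h
  rw [Over, ← HahnSeries.order_eq_orderTop_of_ne_zero (B.ne_zero_of_not_over h), not_le] at h1
  exact_mod_cast h1

theorem lin_ne_zero (γ : QSer) : B.lin γ ≠ 0 := by
  rw [lin]
  split_ifs with h
  · exact X_sub_C_ne_zero _
  · simpa [HahnSeries.leadingCoeff_ne_zero] using B.ne_zero_of_not_over h

open scoped Classical in
theorem natDegree_lin (γ : QSer) : (B.lin γ).natDegree = if B.Over γ then 1 else 0 := by
  rw [lin]
  split_ifs
  · exact natDegree_X_sub_C _
  · exact natDegree_C _

/-- If `γ` climbs over `B`, the term `z y ^ h(B)` takes part in the initial term. Otherwise `γ`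
leaves `λ_B` at an exponent below `h(B)`, and the initial coefficient does not depend on `z`. -/
theorem isLead_sub (γ : QSer) : IsLead (fun z => B.arc z - γ) (B.contact γ) (B.lin γ) := by
  intro z
  simp only [arc_sub]
  rw [contact, lin]
  split_ifs with h
  · refine ⟨le_orderTop_sub HahnSeries.orderTop_single_le h, ?_⟩
    rw [HahnSeries.coeff_sub, HahnSeries.coeff_single_same]
    simp [slope]
  · have h0 := B.ne_zero_of_not_over h
    have hlt := B.order_lt_of_not_over h
    refine ⟨le_orderTop_sub (le_trans (by exact_mod_cast hlt.le) HahnSeries.orderTop_single_le)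
      (HahnSeries.order_eq_orderTop_of_ne_zero h0).le, ?_⟩
    rw [HahnSeries.coeff_sub, HahnSeries.coeff_single_of_ne hlt.ne, zero_sub, eval_C,
      HahnSeries.leadingCoeff_eq]

/-- The order of `∏ (λ_B + z y ^ h(B) - γ)` for generic `z`. -/
def contactSum (s : Multiset QSer) : ℚ := (s.map B.contact).sum

/-- The initial coefficient of `∏ (λ_B + z y ^ h(B) - γ)`. -/
def linProd (s : Multiset QSer) : ℂ[X] := (s.map B.lin).prod

theorem isLead_polyOfRoots (s : Multiset QSer) :
    IsLead (fun z => (polyOfRoots s).eval (B.arc z)) (B.contactSum s) (B.linProd s) := by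
  induction s using Multiset.induction_on with
  | empty =>
    intro z
    simp [polyOfRoots, contactSum, linProd]
  | cons γ s ih =>
    have h := (B.isLead_sub γ).mul ih
    simpa [polyOfRoots, contactSum, linProd] using h

/-- Product rule, one root at a time. Removing a factor over `B` lowers the order by exactly `h(B)`
and matches a factor `1 = (lin γ)'`; removing any other factor lowers it by less, which matches
`(lin γ)' = 0`. -/
theorem isLead_derivative_polyOfRoots (s : Multiset QSer) :
    IsLead (fun z => (derivative (polyOfRoots s)).eval (B.arc z)) (B.contactSum s - B.height)
      (derivative (B.linProd s)) := by
  induction s using Multiset.induction_on with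
  | empty =>
    intro z
    simp [polyOfRoots, linProd]
  | cons γ s ih =>
    have h1 : ∀ z, (derivative (polyOfRoots (γ ::ₘ s))).eval (B.arc z) =
        (polyOfRoots s).eval (B.arc z) +
          (B.arc z - γ) * (derivative (polyOfRoots s)).eval (B.arc z) := by
      intro z
      simp [polyOfRoots]
    have h2 : derivative (B.linProd (γ ::ₘ s)) =
        derivative (B.lin γ) * B.linProd s + B.lin γ * derivative (B.linProd s) := by
      simp [linProd]
    have h3 : B.contactSum (γ ::ₘ s) - B.height =
        B.contact γ + (B.contactSum s - B.height) := by
      simp [contactSum]; ring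
    simp only [h1, h2]
    refine IsLead.add ?_ (h3 ▸ (B.isLead_sub γ).mul ih)
    have hs := B.isLead_polyOfRoots s
    by_cases hγ : B.Over γ
    · have : B.contactSum (γ ::ₘ s) - B.height = B.contactSum s := by
        rw [h3, contact, if_pos hγ]; ring
      rw [this, lin, if_pos hγ]
      simpa using hs
    · rw [lin, if_neg hγ, derivative_C, zero_mul]
      refine hs.of_lt ?_
      rw [h3, contact, if_neg hγ]
      have := B.order_lt_of_not_over hγ
      linarith

theorem orderTop_arc_pos (hstem : 0 < B.stem.orderTop) (hh : 0 < B.height) (z : ℂ) :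
    0 < (B.arc z).orderTop := by
  refine lt_of_lt_of_le (lt_min hstem ?_) HahnSeries.min_orderTop_le_orderTop_add
  exact lt_of_lt_of_le (by exact_mod_cast hh) HahnSeries.orderTop_single_le

theorem linProd_ne_zero (s : Multiset QSer) : B.linProd s ≠ 0 := by
  rw [linProd, Ne, Multiset.prod_eq_zero_iff, Multiset.mem_map]
  rintro ⟨γ, -, h⟩
  exact B.lin_ne_zero γ h

open scoped Classical in
theorem natDegree_linProd (s : Multiset QSer) :
    (B.linProd s).natDegree = (s.filter B.Over).card := by
  induction s using Multiset.induction_on with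
  | empty => simp [linProd]
  | cons γ s ih =>
    have h : B.linProd (γ ::ₘ s) = B.lin γ * B.linProd s := by simp [linProd]
    rw [h, natDegree_mul (B.lin_ne_zero γ) (B.linProd_ne_zero s), ih, natDegree_lin]
    split_ifs with hγ
    · rw [Multiset.filter_cons_of_pos _ hγ, Multiset.card_cons, add_comm]
    · rw [Multiset.filter_cons_of_neg _ hγ, zero_add]

/-- The initial term of `F` along the arcs `λ_B + z y ^ h(B)`. -/
structure HasInitial (F : Ser2) (ν : ℚ) (W : ℂ[X]) : Prop where
  ne_zero : W ≠ 0
  natDegree_eq : W.natDegree = rootCount F {ξ | B.Over ξ}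
  isLead : IsLead (fun z => subst F (B.arc z)) ν W
  isLead_dx : IsLead (fun z => subst (dx F) (B.arc z)) (ν - B.height) (derivative W)
  -- Serves the auxiliary bars of small height that replace the ground bar.
  eq_of_forall_over : (∀ γ ∈ roots F, B.Over γ) →
    ν = yExp F + B.height * rootCount F Set.univ

theorem exists_hasInitial {F : Ser2} (hF : F ≠ 0) (hstem : 0 < B.stem.orderTop)
    (hh : 0 < B.height) : ∃ ν W, B.HasInitial F ν W := by
  classical
  obtain ⟨U, P, s, hs⟩ := exists_isFactorization hF
  have hpos := B.orderTop_arc_pos hstem hh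
  have hU : IsLead (fun z => subst U (B.arc z)) 0 (C (MvPowerSeries.constantCoeff U)) := fun z =>
    ⟨orderTop_subst_nonneg _ (hpos z), by rw [coeff_zero_subst _ (hpos z), eval_C]⟩
  have hdU : IsLead (fun z => subst (dx U) (B.arc z)) 0
      (C (MvPowerSeries.constantCoeff (dx U))) := fun z =>
    ⟨orderTop_subst_nonneg _ (hpos z), by rw [coeff_zero_subst _ (hpos z), eval_C]⟩
  refine ⟨yExp F + B.contactSum s, C (MvPowerSeries.constantCoeff U) * B.linProd s,
    mul_ne_zero (C_ne_zero.2 hs.unit) (B.linProd_ne_zero s), ?_, ?_, ?_, ?_⟩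
  · rw [natDegree_C_mul hs.unit, natDegree_linProd, hs.rootCount_eq]
    rfl
  · have h := ((isLead_y_pow (yExp F)).mul hU).mul (B.isLead_polyOfRoots s)
    simp only [fun z => hs.subst_eq (hpos z)]
    simpa using h
  · simp only [fun z => hs.subst_dx_eq (hpos z)]
    have h1 := hU.mul (B.isLead_derivative_polyOfRoots s)
    -- The term containing `U_x` has order higher by at least `h(B) > 0`, so it does not reach the
    -- initial term.
    have h2 := (hdU.mul (B.isLead_polyOfRoots s)).of_lt (ν' := 0 + (B.contactSum s - B.height))
      (by linarith)
    have h := (isLead_y_pow (yExp F)).mul (h1.add h2)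
    have e1 : (yExp F : ℚ) + (0 + (B.contactSum s - B.height)) =
      yExp F + B.contactSum s - B.height := by ring
    rw [e1] at h
    simpa using h
  · intro hall
    have hc : s.map B.contact = s.map fun _ => B.height := by
      refine Multiset.map_congr rfl fun γ hγ => ?_
      rw [contact, if_pos (hall γ ((hs.mem_roots_iff γ).2 hγ))]
    rw [contactSum, hc, hs.rootCount_eq]
    simp [mul_comm]

variable {B}

/-- The number of roots of the Jacobian over a bar. -/
theorem HasInitial.jac {f g : Ser2} {νf νg : ℚ} {Wf Wg : ℂ[X]} (hf : B.HasInitial f νf Wf)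
    (hg : B.HasInitial g νg Wg) (hstem : 0 < B.stem.orderTop) (hh : 0 < B.height)
    (hne : νf * rootCount g {ξ | B.Over ξ} - νg * rootCount f {ξ | B.Over ξ} ≠ 0) :
    jac f g ≠ 0 ∧ rootCount (jac f g) {ξ | B.Over ξ} + 1 =
      rootCount f {ξ | B.Over ξ} + rootCount g {ξ | B.Over ξ} := by
  have hpos := B.orderTop_arc_pos hstem hh
  rw [← hf.natDegree_eq, ← hg.natDegree_eq] at hne ⊢
  obtain ⟨hW0, hW⟩ := natDegree_weighted_wronskian (a := (νf : ℂ)) (b := (νg : ℂ)) hf.ne_zero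
    hg.ne_zero (by exact_mod_cast hne)
  have h1 := hf.isLead.euler.mul hg.isLead_dx
  have h2 := hf.isLead_dx.mul hg.isLead.euler
  -- Both products start at the same exponent, so their initial polynomials may be subtracted.
  have e : νf - B.height + νg = νf + (νg - B.height) := by ring
  rw [e] at h2
  have h := h1.sub h2
  simp only [← fun z => y_mul_subst_jac f g (hpos z)] at h
  have hJ : Ser2.jac f g ≠ 0 := by
    intro h0
    apply hW0
    apply Polynomial.funext
    intro z
    rw [← (h z).2, eval_zero]
    simp only [h0, subst_zero, mul_zero]
    rfl
  refine ⟨hJ, ?_⟩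
  -- The initial polynomial of `J` from its own factorization, whose degree counts roots; the factor
  -- `y` only shifts the exponent.
  obtain ⟨νJ, WJ, hWJ⟩ := B.exists_hasInitial hJ hstem hh
  have h3 := (isLead_y_pow 1).mul hWJ.isLead
  rw [one_mul] at h3
  simp only [pow_one] at h3
  rw [← hWJ.natDegree_eq, (h3.unique h hWJ.ne_zero hW0).2, hW]

/-- The order is `ν` off the finitely many zeros of `W`, and two cofinite subsets of `ℂ` meet, so
the value selected by `Classical.epsilon` can only be `ν`. -/
theorem HasInitial.nu_eq {F : Ser2} {ν : ℚ} {W : ℂ[X]} (hF : B.HasInitial F ν W)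
    (hh : B.height ≠ 0) : B.nu F = ν := by
  rw [nu, if_neg hh]
  have hcof : ∀ᶠ z : ℂ in cofinite, (subst F (B.arc z)).orderTop = (ν : WithTop ℚ) := by
    have : {z : ℂ | W.eval z = 0}.Finite := by
      refine W.roots.toFinset.finite_toSet.subset fun z hz => ?_
      simpa [hF.ne_zero] using hz
    filter_upwards [this.compl_mem_cofinite] with z hz
    exact hF.isLead.orderTop_eq hz
  have hspec := Classical.epsilon_spec (p := fun n : ℚ =>
    ∀ᶠ z : ℂ in cofinite, (subst F (B.arc z)).orderTop = (n : WithTop ℚ)) ⟨ν, hcof⟩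
  obtain ⟨z, hz1, hz2⟩ := (hspec.and hcof).exists
  exact WithTop.coe_injective (hz1.symm.trans hz2)

end Bar

/-! ### Polar roots are exactly the roots of the Jacobian. -/

namespace Ser2

open QSer

theorem orderTop_subst_pos {F : Ser2} (hF : MvPowerSeries.constantCoeff F = 0) {ξ : QSer}
    (hξ : 0 < ξ.orderTop) : 0 < (subst F ξ).orderTop := by
  refine lt_of_le_of_ne (orderTop_subst_nonneg F hξ) fun h => ?_
  refine HahnSeries.coeff_orderTop_ne (g := 0) h.symm ?_
  rw [coeff_zero_subst F hξ, hF]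

/-- If `f(γ, y) = 0`, the chain rule leaves `y J = -f_x · y d/dy g(γ, y)`. Simplicity makes `f_x`
and `g(γ, y)` nonzero, and `g(γ, y)` has positive order, so its derivative is nonzero. The case of
`g` is symmetric. -/
theorem subst_jac_ne_zero {f g : Ser2} (hf : MvPowerSeries.constantCoeff f = 0)
    (hg : MvPowerSeries.constantCoeff g = 0) {γ : QSer} (hγ : 0 < γ.orderTop)
    (h0 : subst f γ * subst g γ = 0) (h1 : subst (dx (f * g)) γ ≠ 0) :
    subst (jac f g) γ ≠ 0 := by
  intro hJ
  have hy := y_mul_subst_jac f g hγ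
  rw [hJ, mul_zero] at hy
  rw [dx_mul, subst_add, subst_mul _ _ hγ, subst_mul _ _ hγ] at h1
  rcases mul_eq_zero.1 h0 with h | h
  · rw [h, zero_mul, zero_add] at h1
    rw [h, map_zero, zero_mul, zero_sub, eq_comm, neg_eq_zero, mul_eq_zero] at hy
    exact hy.elim (right_ne_zero_of_mul h1)
      (euler_ne_zero (left_ne_zero_of_mul h1) (orderTop_subst_pos hg hγ))
  · rw [h, zero_mul, add_zero] at h1
    rw [h, map_zero, mul_zero, sub_zero, eq_comm, mul_eq_zero] at hy
    exact hy.elim (euler_ne_zero (left_ne_zero_of_mul h1) (orderTop_subst_pos hf hγ))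
      (right_ne_zero_of_mul h1)

theorem polarRoots_eq {f g : Ser2} (hf : MvPowerSeries.constantCoeff f = 0)
    (hg : MvPowerSeries.constantCoeff g = 0) (hsimple : HasSimpleRoots f g) :
    polarRoots f g = roots (jac f g) := by
  refine Set.Subset.antisymm (fun γ hγ => hγ.1) fun γ hγ => ⟨hγ, fun h0 => ?_⟩
  have hpos := hγ.1.1
  have h1 := hsimple γ ⟨hγ.1, by rw [subst_mul _ _ hpos, h0]⟩
  -- The infimum of the empty set is `0`, so the value `1` shows that the set is nonempty and that
  -- `1` belongs to it.
  have hmem := Nat.sInf_mem (Nat.nonempty_of_pos_sInf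
    (show 0 < sInf {k : ℕ | subst (dx^[k] (f * g)) γ ≠ 0} from by
      rw [show sInf {k : ℕ | subst (dx^[k] (f * g)) γ ≠ 0} = 1 from h1]; exact one_pos))
  rw [show sInf {k : ℕ | subst (dx^[k] (f * g)) γ ≠ 0} = 1 from h1] at hmem
  exact subst_jac_ne_zero hf hg hpos h0 hmem hγ.2

theorem rootCount_congr {F : Ser2} {S T : Set QSer} (h : roots F ∩ S = roots F ∩ T) :
    rootCount F S = rootCount F T := by
  rw [rootCount, rootCount, h]

theorem roots_mul (f g : Ser2) : roots (f * g) = roots f ∪ roots g := by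
  ext ξ
  constructor
  · rintro ⟨h, h0⟩
    rw [subst_mul _ _ h.1, mul_eq_zero] at h0
    exact h0.imp (fun h0 => ⟨h, h0⟩) fun h0 => ⟨h, h0⟩
  · rintro (⟨h, h0⟩ | ⟨h, h0⟩) <;> exact ⟨h, by rw [subst_mul _ _ h.1, h0]; simp⟩

/-- A positive number that is less than or equal to the orders of all roots. -/
theorem exists_le_orderTop_roots {F : Ser2} (hF : F ≠ 0) :
    ∃ d : ℚ, 0 < d ∧ ∀ γ ∈ roots F, (d : WithTop ℚ) ≤ γ.orderTop := by
  have h : ∀ γ ∈ roots F, ∃ d : ℚ, 0 < d ∧ (d : WithTop ℚ) ≤ γ.orderTop := fun γ hγ => by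
    obtain ⟨d, hd, -, hle⟩ := exists_pos_le_orderTop hγ.1.1
    exact ⟨d, hd, hle⟩
  choose! d hd hle using h
  rcases (roots F).eq_empty_or_nonempty with he | he
  · exact ⟨1, one_pos, by simp [he]⟩
  · obtain ⟨γ, hγ, hmin⟩ := (finite_roots hF).exists_minimalFor d _ he
    refine ⟨d γ, hd γ hγ, fun γ' hγ' => le_trans ?_ (hle γ' hγ')⟩
    have h1 : d γ ≤ d γ' := (le_total (d γ) (d γ')).elim id fun h => hmin hγ' h
    exact_mod_cast h1

end Ser2

/-! ### Zeros of polynomials and of sums of simple fractions. -/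

namespace Polynomial

theorem finsum_rootMultiplicity {p : ℂ[X]} (hp : p ≠ 0) :
    {z | p.IsRoot z}.Finite ∧ ∑ᶠ z ∈ {z | p.IsRoot z}, p.rootMultiplicity z = p.natDegree := by
  classical
  have hset : {z | p.IsRoot z} = (p.roots.toFinset : Set ℂ) := by
    ext z
    simp [hp]
  rw [hset]
  refine ⟨Finset.finite_toSet _, ?_⟩
  rw [finsum_mem_coe_finset, (IsAlgClosed.splits p).natDegree_eq_card_roots,
    ← Multiset.toFinset_sum_count_eq]
  exact Finset.sum_congr rfl fun z _ => (count_roots p).symm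

end Polynomial

namespace RatFunc

open Polynomial

theorem num_div_of_isCoprime {p q : ℂ[X]} (hq : q.Monic) (h : IsCoprime p q) :
    (algebraMap ℂ[X] (RatFunc ℂ) p / algebraMap ℂ[X] (RatFunc ℂ) q).num = p := by
  have hg : gcd p q = 1 := by
    rw [← normalize_gcd]
    exact normalize_eq_one.2 ((gcd_isUnit_iff p q).2 h)
  rw [num_div, hg]
  simp [EuclideanDomain.div_one, hq.leadingCoeff]

/-- The zeros of `∑ a_c / (z - c)` when no residue vanishes and the residues have nonzero sum. -/
theorem num_sum_simple_poles (S : Finset ℂ) (a : ℂ → ℂ) (ha : ∀ c ∈ S, a c ≠ 0)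
    (hsum : ∑ c ∈ S, a c ≠ 0) :
    (∑ c ∈ S, RatFunc.C (a c) / (RatFunc.X - RatFunc.C c)).num ≠ 0 ∧
    (∑ c ∈ S, RatFunc.C (a c) / (RatFunc.X - RatFunc.C c)).num.natDegree + 1 = S.card := by
  set q : ℂ[X] := ∏ c ∈ S, (Polynomial.X - Polynomial.C c) with hq
  set e : ℂ → ℂ[X] := fun c => ∏ d ∈ S.erase c, (Polynomial.X - Polynomial.C d) with he
  set p : ℂ[X] := ∑ c ∈ S, Polynomial.C (a c) * e c with hp
  have hqm : q.Monic := monic_prod_of_monic _ _ fun c _ => monic_X_sub_C c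
  have hem : ∀ c, (e c).Monic := fun c => monic_prod_of_monic _ _ fun d _ => monic_X_sub_C d
  have hed : ∀ c ∈ S, (e c).natDegree = S.card - 1 := fun c hc => by
    rw [he, natDegree_prod_of_monic _ _ fun d _ => monic_X_sub_C d]
    simp [Finset.card_erase_of_mem hc]
  have hS : 0 < S.card := by
    rw [Finset.card_pos]
    by_contra h
    rw [Finset.not_nonempty_iff_eq_empty.1 h] at hsum
    simp at hsum
  have hpc : p.coeff (S.card - 1) = ∑ c ∈ S, a c := by
    rw [hp, finsetSum_coeff]
    refine Finset.sum_congr rfl fun c hc => ?_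
    rw [Polynomial.coeff_C_mul, ← hed c hc, (hem c).coeff_natDegree, mul_one]
  have hpd : p.natDegree = S.card - 1 := by
    refine natDegree_eq_of_le_of_coeff_ne_zero ?_ (by rwa [hpc])
    refine natDegree_sum_le_of_forall_le _ _ fun c hc => ?_
    exact (natDegree_C_mul_le _ _).trans (hed c hc).le
  have hp0 : p ≠ 0 := by
    intro h
    rw [h, Polynomial.coeff_zero] at hpc
    exact hsum hpc.symm
  -- At a pole `c` only the summand of `c` survives, with value `a c ∏ (c - d) ≠ 0`; hence `p` and
  -- `q` share no root, and `p / q` is in lowest terms.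
  have hcop : IsCoprime p q := by
    refine IsCoprime.prod_right fun c hc => IsCoprime.symm ?_
    rw [(irreducible_X_sub_C c).coprime_iff_not_dvd, dvd_iff_isRoot, IsRoot, hp, eval_finsetSum,
      Finset.sum_eq_single c]
    · rw [Polynomial.eval_mul, Polynomial.eval_C, he]
      refine mul_ne_zero (ha c hc) ?_
      rw [eval_prod, Finset.prod_ne_zero_iff]
      intro d hd
      simpa [sub_eq_zero] using (Finset.ne_of_mem_erase hd).symm
    · intro d hd hdc
      rw [Polynomial.eval_mul, he, eval_prod, Finset.prod_eq_zero (Finset.mem_erase.2 ⟨hdc.symm, hc⟩)]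
      · simp
      · simp
    · exact fun h => absurd hc h
  have hR : ∑ c ∈ S, RatFunc.C (a c) / (RatFunc.X - RatFunc.C c) =
      algebraMap ℂ[X] (RatFunc ℂ) p / algebraMap ℂ[X] (RatFunc ℂ) q := by
    rw [hp, map_sum, Finset.sum_div]
    refine Finset.sum_congr rfl fun c hc => ?_
    have h1 : q = (Polynomial.X - Polynomial.C c) * e c := by
      rw [hq, he, Finset.mul_prod_erase S (fun c => Polynomial.X - Polynomial.C c) hc]
    have h2 : algebraMap ℂ[X] (RatFunc ℂ) (e c) ≠ 0 :=
      RatFunc.algebraMap_ne_zero (hem c).ne_zero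
    rw [h1, map_mul, map_mul, map_sub, RatFunc.algebraMap_C, RatFunc.algebraMap_C,
      RatFunc.algebraMap_X, mul_div_mul_right _ _ h2]
  rw [hR, num_div_of_isCoprime hqm hcop, hpd]
  exact ⟨hp0, by omega⟩

end RatFunc

/-! ### Counts over a bar, the ground bar, and the final theorem. -/

namespace Bar

open QSer

variable {f g : Ser2} (B : Bar)

theorem Delta_eq (c : ℂ) : B.Delta f g c =
    B.nu f * B.mult g c - B.mult f c * B.nu g := by
  rw [Delta, Matrix.det_fin_two_of]

theorem finite_points (hf : f ≠ 0) (hg : g ≠ 0) : (B.points f g).Finite := by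
  refine ((finite_roots (mul_ne_zero hf hg)).image B.slope).subset ?_
  rintro c ⟨l, hl, hc⟩
  exact ⟨l, hl, ((B.climbsAt_iff l c).1 hc).2⟩

/-- Each root over `B` climbs at exactly one point, its slope, so the sum partitions the roots over
`B` by slope. -/
theorem sum_mult {F : Ser2} (hF : F ≠ 0) (S : Finset ℂ)
    (hS : ∀ γ ∈ roots F, B.Over γ → B.slope γ ∈ S) :
    ∑ c ∈ S, B.mult F c = rootCount F {ξ | B.Over ξ} := by
  classical
  obtain ⟨U, P, s, hs⟩ := exists_isFactorization hF
  rw [hs.rootCount_eq]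
  have h : ∀ c ∈ S, B.mult F c =
      ((s.filter (· ∈ {ξ | B.Over ξ})).map B.slope).count c := by
    intro c _
    rw [mult, hs.rootCount_eq, Multiset.count_map, Multiset.filter_filter]
    congr 1
    refine Multiset.filter_congr fun ξ _ => ?_
    rw [Set.mem_ofPred_eq, climbsAt_iff, Set.mem_ofPred_eq, and_comm, @eq_comm _ (B.slope ξ)]
  rw [Finset.sum_congr rfl h, Multiset.sum_count_eq_card, Multiset.card_map]
  intro c hc
  obtain ⟨γ, hγ, rfl⟩ := Multiset.mem_map.1 hc
  rw [Multiset.mem_filter] at hγ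
  exact hS γ ((hs.mem_roots_iff γ).2 hγ.1) hγ.2

theorem slope_mem_points {γ : QSer} (hγ : γ ∈ roots (f * g)) (h : B.Over γ) :
    B.slope γ ∈ B.points f g :=
  ⟨γ, hγ, (B.climbsAt_iff γ _).2 ⟨h, rfl⟩⟩

theorem finsum_mult (hf : f ≠ 0) (hg : g ≠ 0) :
    ∑ᶠ c ∈ B.points f g, ((B.mult f c : ℤ) + (B.mult g c : ℤ)) =
      rootCount f {ξ | B.Over ξ} + rootCount g {ξ | B.Over ξ} := by
  have hfin := B.finite_points hf hg
  rw [finsum_mem_eq_finite_toFinset_sum _ hfin, Finset.sum_add_distrib, ← Nat.cast_sum,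
    ← Nat.cast_sum, B.sum_mult hf, B.sum_mult hg]
  · exact fun γ hγ h => hfin.mem_toFinset.2 (B.slope_mem_points (roots_mul f g ▸ Or.inr hγ) h)
  · exact fun γ hγ h => hfin.mem_toFinset.2 (B.slope_mem_points (roots_mul f g ▸ Or.inl hγ) h)

theorem nonCollinear_eq (hf : f ≠ 0) (hg : g ≠ 0) : B.nonCollinear f g =
    (((B.finite_points hf hg).toFinset.filter fun c => B.Delta f g c ≠ 0 : Finset ℂ) : Set ℂ) := by
  ext c
  simp [nonCollinear]

theorem finsum_Delta (hf : f ≠ 0) (hg : g ≠ 0) : ∑ᶠ c ∈ B.nonCollinear f g, B.Delta f g c =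
    B.nu f * rootCount g {ξ | B.Over ξ} - rootCount f {ξ | B.Over ξ} * B.nu g := by
  have hfin := B.finite_points hf hg
  rw [B.nonCollinear_eq hf hg, finsum_mem_coe_finset, Finset.sum_filter_ne_zero,
    Finset.sum_congr rfl fun c _ => B.Delta_eq c, Finset.sum_sub_distrib, ← Finset.mul_sum,
    ← Finset.sum_mul, ← Nat.cast_sum, ← Nat.cast_sum, B.sum_mult hf, B.sum_mult hg]
  · exact fun γ hγ h => hfin.mem_toFinset.2 (B.slope_mem_points (roots_mul f g ▸ Or.inr hγ) h)
  · exact fun γ hγ h => hfin.mem_toFinset.2 (B.slope_mem_points (roots_mul f g ▸ Or.inl hγ) h)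

theorem meroZeros_count (hf : f ≠ 0) (hg : g ≠ 0)
    (hsum : ∑ᶠ c ∈ B.nonCollinear f g, B.Delta f g c ≠ 0) :
    (B.meroZeros f g).Finite ∧ B.m f g + 1 = B.n f g := by
  have hR : B.ratFun f g =
      ∑ c ∈ (B.finite_points hf hg).toFinset.filter fun c => B.Delta f g c ≠ 0,
        RatFunc.C ((B.Delta f g c : ℚ) : ℂ) / (RatFunc.X - RatFunc.C c) := by
    rw [ratFun, finsum_mem_eq_finite_toFinset_sum _ (B.finite_points hf hg)]
    refine (Finset.sum_filter_of_ne fun c _ hc => ?_).symm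
    contrapose! hc
    rw [hc]
    simp
  rw [B.nonCollinear_eq hf hg, finsum_mem_coe_finset] at hsum
  obtain ⟨h0, hdeg⟩ := RatFunc.num_sum_simple_poles
    ((B.finite_points hf hg).toFinset.filter fun c => B.Delta f g c ≠ 0)
    (fun c => ((B.Delta f g c : ℚ) : ℂ))
    (fun c hc => by exact_mod_cast (Finset.mem_filter.1 hc).2) (by exact_mod_cast hsum)
  rw [← hR] at h0 hdeg
  obtain ⟨hfin, hcount⟩ := Polynomial.finsum_rootMultiplicity h0
  refine ⟨hfin, ?_⟩
  rw [m, n, B.nonCollinear_eq hf hg, Set.ncard_coe_finset, ← hdeg, ← hcount]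
  rfl

theorem isTrunk_subset {T : Set QSer} (hT : IsTrunk f g T) : T ⊆ roots (f * g) := by
  induction hT with
  | main => exact subset_rfl
  | grow T h l hT hh hl ih => exact fun m hm => ih hm.1

/-- Truncation only deletes terms of an arc of positive order, and the height is the contact order
of two such arcs. Hence the arcs of every bar other than the ground bar can be substituted. -/
theorem pos_of_isBarOf (hB : B.IsBarOf f g) (hne : B ≠ ground) :
    0 < B.stem.orderTop ∧ 0 < B.height := by
  rcases hB with h | ⟨T, hT, ⟨⟨l, hl, m, hm, hheight⟩, -⟩, k, hk, hstem⟩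
  · exact absurd h hne
  have hpos : ∀ l ∈ T, 0 < l.orderTop := fun l hl => (isTrunk_subset hT hl).1.1
  refine ⟨?_, ?_⟩
  · refine lt_of_lt_of_le (hpos k hk) ?_
    rw [HahnSeries.le_orderTop_iff_forall, hstem]
    intro e he
    rw [HahnSeries.coeff_truncLT, HahnSeries.coeff_eq_zero_of_lt_orderTop he, ite_self]
  · have h : (0 : WithTop ℚ) < (l - m).orderTop :=
      lt_of_lt_of_le (lt_min (hpos l hl) (hpos m hm)) HahnSeries.min_orderTop_le_orderTop_sub
    rw [← hheight] at h
    exact_mod_cast h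

theorem polarOver_eq (hf : MvPowerSeries.constantCoeff f = 0)
    (hg : MvPowerSeries.constantCoeff g = 0) (hsimple : HasSimpleRoots f g) :
    B.polarOver f g = roots (jac f g) ∩ {ξ | B.Over ξ} := by
  ext γ
  rw [polarOver, polarRoots_eq hf hg hsimple]
  simp [exists_climbsAt_iff]

theorem over_ground {ξ : QSer} (hξ : 0 < ξ.orderTop) : ground.Over ξ := by
  simpa [Over, ground] using hξ.le

theorem roots_inter_over_ground (F : Ser2) : roots F ∩ {ξ | ground.Over ξ} = roots F :=
  Set.inter_eq_left.2 fun _ hξ => over_ground hξ.1.1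

theorem rootCount_over_ground (F : Ser2) :
    rootCount F {ξ | ground.Over ξ} = rootCount F Set.univ :=
  rootCount_congr (by rw [roots_inter_over_ground, Set.inter_univ])

/-- The total number of roots of the Jacobian. -/
theorem rootCount_jac (hf : f ≠ 0) (hg : g ≠ 0)
    (hne : (yExp f : ℚ) * rootCount g Set.univ - rootCount f Set.univ * (yExp g : ℚ) ≠ 0) :
    jac f g ≠ 0 ∧ rootCount (jac f g) Set.univ + 1 =
      rootCount f Set.univ + rootCount g Set.univ := by
  have key : ∀ d : ℚ, 0 < d → (∀ γ ∈ roots (f * g), (d : WithTop ℚ) ≤ γ.orderTop) →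
      jac f g ≠ 0 ∧ rootCount (jac f g) {ξ | Over ⟨d, 0⟩ ξ} + 1 =
        rootCount f Set.univ + rootCount g Set.univ := by
    intro d hd hle
    set A : Bar := ⟨d, 0⟩ with hA
    have hstem : 0 < A.stem.orderTop := by simp [hA]
    have hover : ∀ γ ∈ roots (f * g), A.Over γ := fun γ hγ => by
      simpa [Over, hA] using hle γ hγ
    have hof : ∀ γ ∈ roots f, A.Over γ := fun γ hγ => hover γ (roots_mul f g ▸ Or.inl hγ)
    have hog : ∀ γ ∈ roots g, A.Over γ := fun γ hγ => hover γ (roots_mul f g ▸ Or.inr hγ)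
    have hcf : rootCount f {ξ | A.Over ξ} = rootCount f Set.univ :=
      rootCount_congr (by rw [Set.inter_univ]; exact Set.inter_eq_left.2 hof)
    have hcg : rootCount g {ξ | A.Over ξ} = rootCount g Set.univ :=
      rootCount_congr (by rw [Set.inter_univ]; exact Set.inter_eq_left.2 hog)
    obtain ⟨νf, Wf, hWf⟩ := A.exists_hasInitial hf hstem hd
    obtain ⟨νg, Wg, hWg⟩ := A.exists_hasInitial hg hstem hd
    -- With `p`, `q` the numbers of roots, `(E₁ + d p) q - (E₂ + d q) p = E₁ q - E₂ p`,
    -- independently of `d`.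
    have := hWf.jac hWg hstem hd (by
      rw [hWf.eq_of_forall_over hof, hWg.eq_of_forall_over hog, hcf, hcg]
      convert hne using 1
      ring)
    rwa [hcf, hcg] at this
  -- `key` is used twice: first to see that `J ≠ 0`, so that the orders of its roots have a positive
  -- lower bound, and then with a height so small that all roots of `J` lie over the auxiliary bar.
  obtain ⟨d₁, hd₁, h₁⟩ := exists_le_orderTop_roots (mul_ne_zero hf hg)
  have hJ := (key d₁ hd₁ h₁).1
  obtain ⟨d₂, hd₂, h₂⟩ := exists_le_orderTop_roots hJ
  refine ⟨hJ, ?_⟩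
  rw [← (key (min d₁ d₂) (lt_min hd₁ hd₂) fun γ hγ => le_trans
    (by exact_mod_cast min_le_left d₁ d₂) (h₁ γ hγ)).2]
  congr 1
  refine rootCount_congr ?_
  rw [Set.inter_univ, eq_comm]
  refine Set.inter_eq_left.2 fun γ hγ => ?_
  have : ((min d₁ d₂ : ℚ) : WithTop ℚ) ≤ γ.orderTop :=
    le_trans (by exact_mod_cast min_le_right d₁ d₂) (h₂ γ hγ)
  simpa [Over] using this

theorem rootCount_jac_over (hf : f ≠ 0) (hg : g ≠ 0) (hB : B.IsBarOf f g)
    (hsum : ∑ᶠ c ∈ B.nonCollinear f g, B.Delta f g c ≠ 0) :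
    jac f g ≠ 0 ∧ rootCount (jac f g) {ξ | B.Over ξ} + 1 =
      rootCount f {ξ | B.Over ξ} + rootCount g {ξ | B.Over ξ} := by
  rw [B.finsum_Delta hf hg] at hsum
  by_cases hne : B = ground
  · subst hne
    simp only [rootCount_over_ground] at hsum ⊢
    exact rootCount_jac hf hg (by simpa [nu, ground] using hsum)
  · obtain ⟨hstem, hh⟩ := B.pos_of_isBarOf hB hne
    obtain ⟨νf, Wf, hWf⟩ := B.exists_hasInitial hf hstem hh
    obtain ⟨νg, Wg, hWg⟩ := B.exists_hasInitial hg hstem hh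
    rw [hWf.nu_eq hh.ne', hWg.nu_eq hh.ne', mul_comm (_ : ℚ) νg] at hsum
    exact hWf.jac hWg hstem hh hsum

end Bar

theorem mainTheorem9 (f g : Ser2) (hf : f.IsConvergent) (hg : g.IsConvergent)
    (hf0 : f ≠ 0) (hg0 : g ≠ 0)
    (hfO : MvPowerSeries.constantCoeff f = 0) (hgO : MvPowerSeries.constantCoeff g = 0)
    (hsimple : HasSimpleRoots f g) :
    (∀ B : Bar, B.IsBarOf f g →
      (∑ᶠ c ∈ B.nonCollinear f g, B.Delta f g c) ≠ 0 →
        (B.meroZeros f g).Finite ∧ B.m f g + 1 = B.n f g ∧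
        (B.polarOver f g).Finite ∧
        (Ser2.rootCount (Ser2.jac f g) (B.polarOver f g) : ℤ) =
          (∑ᶠ c ∈ B.points f g, ((B.mult f c : ℤ) + (B.mult g c : ℤ))) - 1) ∧
    ((Ser2.rootCount f Set.univ : ℤ) * (g.yExp : ℤ) -
        (Ser2.rootCount g Set.univ : ℤ) * (f.yExp : ℤ) ≠ 0 →
      (polarRoots f g).Finite ∧
      (Ser2.rootCount (Ser2.jac f g) (polarRoots f g) : ℤ) =
        (Ser2.rootCount f Set.univ : ℤ) + (Ser2.rootCount g Set.univ : ℤ) - 1) := by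
  refine ⟨fun B hB hsum => ?_, fun hne => ?_⟩
  · obtain ⟨hfin, hm⟩ := B.meroZeros_count hf0 hg0 hsum
    obtain ⟨hJ, hcount⟩ := B.rootCount_jac_over hf0 hg0 hB hsum
    refine ⟨hfin, hm, ?_, ?_⟩
    · rw [B.polarOver_eq hfO hgO hsimple]
      exact (finite_roots hJ).inter_of_left _
    · rw [B.finsum_mult hf0 hg0, B.polarOver_eq hfO hgO hsimple,
        rootCount_congr (T := {ξ | B.Over ξ}) (by rw [← Set.inter_assoc, Set.inter_self])]
      omega
  · obtain ⟨hJ, hcount⟩ := Bar.rootCount_jac hf0 hg0 (by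
      intro h
      apply hne
      have h' : (Ser2.rootCount f Set.univ : ℚ) * (g.yExp : ℚ) -
        (Ser2.rootCount g Set.univ : ℚ) * (f.yExp : ℚ) = 0 := by linarith
      exact_mod_cast h')
    rw [polarRoots_eq hfO hgO hsimple]
    refine ⟨finite_roots hJ, ?_⟩
    rw [rootCount_congr (T := Set.univ) (by rw [Set.inter_self, Set.inter_univ])]
    omega

end
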